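/- **Setting.** Let $D\subset\mathbb R^3$ be a regular dodecahedron centered at the origin, $\iota$ the antipodal involution, $\mathcal I$ the group of orientation preserving isometries of $D$, and $\mathcal K$ the set of (five) inscribed cubes of $D$, i.e. cubes whose eight vertices are vertices of $D$. Put $V_o:=\mathbb Z^{\mathcal K}/\mathbb Z\sum_{e\in\mathcal K}e$, a $\mathbb Z\mathcal I$-module; the image of $e\in\mathcal K$ in $V_o$ is denoted $\bar e$. Let $\hat\Sigma$ be obtained from the boundary of $D$ by removing, in an $\mathcal I$- and $\iota$-invariant manner, a small triangle around each vertex, and let $\Sigma$ be obtained from $\hat\Sigma$ by identifying antipodal points of $\partial\hat\Sigma$. This is a closed oriented surface of genus $10$ on which $\mathcal I$ acts, with a cell structure whose $2$-cells are the $12$ truncated faces of $D$, and whose $1$-cells are $30$ cells of edge type (lying on the edges of $D$) and $30$ cells of truncation type (images of the sides of the triangles). Let $0\to C_2\xrightarrow{\partial_2}C_1=C_{\rm edge}\oplus C_{\rm trc}\xrightarrow{\partial_1}C_0\to 0$ be its cellular chain complex of $\mathbb Z\mathcal I$-modules, and put $Z_1=\ker\partial_1$, $B_1=\operatorname{im}\partial_2$,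 $H_1(\Sigma)=Z_1/B_1$. Let $p:Z_1\to H_1(\Sigma)$ be the projection and $$p_*:\operatorname{Hom}_{\mathbb Z\mathcal I}(V_o,Z_1)\to\operatorname{Hom}_{\mathbb Z\mathcal I}(V_o,H_1(\Sigma))$$ the induced map. For a vertex $x$ of $D$ let $\delta_x\in C_{\rm trc}$ be the counterclockwise boundary of the triangle at $x$. For an oriented edge $y$ of $D$, viewed also as an oriented $1$-cell of edge type, let $\delta_y:=y-\iota y\in C_{\rm edge}$. Fix $e\in\mathcal K$, and let $E$ be one of the two $4$-element sets of vertices of $e$ such that the vertex set of $e$ is the disjoint union of $E$ and $\iota E$, and no two elements of $E$ span an edge of the cube. Put $$\delta^E_{\rm trc}:=\sum_{x\in E}\delta_x,\qquad \delta^E_{\rm edge}:=\sum_{x\in E}\ \sum_{y\,:\,\mathrm{in}(y)=x}\delta_y ,$$ where $\mathrm{in}(y)$ is the initial point of $y$. **Proposition.** There are unique $u_{\rm trc},u_{\rm edge}\in\operatorname{Hom}_{\mathbb Z\mathcal I}(V_o,Z_1)$ with $u_{\rm trc}(\bar e)=\delta^E_{\rm trc}$ and $u_{\rm edge}(\bar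 e)=\delta^E_{\rm edge}$. Moreover: 1. $\operatorname{Hom}_{\mathbb Z\mathcal I}(V_o,B_1)=0$. 2. $\operatorname{Hom}_{\mathbb Z\mathcal I}(V_o,Z_1)$ is the free abelian group with basis $(u_{\rm trc},u_{\rm edge})$. 3. $p_*(u_{\rm edge})$ is divisible by $3$: there is $w\in\operatorname{Hom}_{\mathbb Z\mathcal I}(V_o,H_1(\Sigma))$ with $3w=p_*(u_{\rm edge})$, and $\operatorname{Hom}_{\mathbb Z\mathcal I}(V_o,H_1(\Sigma))$ is the free abelian group with basis $(p_*(u_{\rm trc}),w)$. 4. The cokernel of $p_*$ is cyclic of order $3$. -/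

import Mathlib

open scoped Matrix

namespace Dodec

/-! ## The regular dodecahedron `D` and its rotation group -/

/-- `x` is one of the twenty vertices of the regular dodecahedron `D` in oriented Euclidean `ℝ³`,
centered at the origin, with vertices `(±1, ±1, ±1)` and the cyclic permutations of
`(0, ±φ⁻¹, ±φ)`, where `φ` is the golden ratio. Its edges have length `2 / φ`. -/
def IsVertex (x : Fin 3 → ℝ) : Prop :=
  (∀ i, |x i| = 1) ∨
    ∃ i, x i = 0 ∧ |x (i + 1)| = Real.goldenRatio⁻¹ ∧ |x (i + 2)| = Real.goldenRatio

/-- The set of vertices of `D`. -/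
abbrev Vertex : Type := {x : Fin 3 → ℝ // IsVertex x}

instance : Finite Vertex := by
  let S : Set ℝ := {0, 1, -1, Real.goldenRatio, -Real.goldenRatio, Real.goldenRatio⁻¹,
    -Real.goldenRatio⁻¹}
  have hS : S.Finite := by simp [S]
  refine Set.Finite.subset (Set.Finite.pi' (fun _ : Fin 3 => hS)) ?_
  have key : ∀ {a b : ℝ}, |a| = b → a = b ∨ a = -b := fun {a b} h => by
    rcases abs_choice a with h' | h' <;> rw [h'] at h
    · exact Or.inl h
    · exact Or.inr (by linarith)
  rintro x (h | ⟨i, h0, h1, h2⟩) j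
  · rcases key (h j) with h | h <;> simp [S, h]
  · have hj : j = i ∨ j = i + 1 ∨ j = i + 2 := by
      clear h0 h1 h2
      revert i j
      decide
    rcases hj with rfl | rfl | rfl
    · simp [S, h0]
    · rcases key h1 with h | h <;> simp [S, h]
    · rcases key h2 with h | h <;> simp [S, h]

noncomputable instance : Fintype Vertex := Fintype.ofFinite _

/-- The antipodal involution `ι` on vertices. -/
def Vertex.anti (x : Vertex) : Vertex :=
  ⟨-x.1, by
    rcases x.2 with h | ⟨i, h0, h1, h2⟩
    · exact Or.inl fun i => by simpa using h i
    · exact Or.inr ⟨i, by simpa using h0, by simpa using h1, by simpa using h2⟩⟩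

@[simp] theorem Vertex.anti_anti (x : Vertex) : x.anti.anti = x :=
  Subtype.ext (neg_neg x.1)

/-- The icosahedral group: all orientation preserving isometries of `D`. -/
def icosahedralGroup : Subgroup (Matrix.specialOrthogonalGroup (Fin 3) ℝ) where
  carrier := {g | ∀ x : Fin 3 → ℝ, IsVertex (g.1 *ᵥ x) ↔ IsVertex x}
  one_mem' := fun x => by simp
  mul_mem' := fun {a b} ha hb x => by
    have : (a * b).1 *ᵥ x = a.1 *ᵥ (b.1 *ᵥ x) := by simp [Matrix.mulVec_mulVec]
    rw [this, ha, hb]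
  inv_mem' := fun {a} ha x => by
    have h : a.1 *ᵥ ((a⁻¹).1 *ᵥ x) = x := by
      have : a.1 * (a⁻¹).1 = 1 := congrArg Subtype.val (mul_inv_cancel a)
      rw [Matrix.mulVec_mulVec, this, Matrix.one_mulVec]
    rw [← ha, h]

/-- The icosahedral group, as a type. -/
def Icos : Type := ↥icosahedralGroup

noncomputable instance : Group Icos := inferInstanceAs (Group ↥icosahedralGroup)

/-- The rotation matrix of an element of the icosahedral group. -/
def Icos.mat (g : Icos) : Matrix (Fin 3) (Fin 3) ℝ := g.1.1

theorem Icos.mat_one : (1 : Icos).mat = 1 := rfl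

theorem Icos.mat_mul (g h : Icos) : (g * h).mat = g.mat * h.mat := rfl

theorem Icos.transpose_mul (g : Icos) : g.matᵀ * g.mat = 1 := by
  have h := (Matrix.mem_orthogonalGroup_iff' (Fin 3) ℝ).1
    (Matrix.mem_specialOrthogonalGroup_iff.1 g.1.2).1
  simpa [Matrix.star_eq_conjTranspose, Icos.mat] using h

theorem Icos.det_mat (g : Icos) : g.mat.det = 1 :=
  (Matrix.mem_specialOrthogonalGroup_iff.1 g.1.2).2

theorem Icos.dot (g : Icos) (x y : Fin 3 → ℝ) : (g.mat *ᵥ x) ⬝ᵥ (g.mat *ᵥ y) = x ⬝ᵥ y := by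
  rw [Matrix.dotProduct_mulVec, Matrix.vecMul_mulVec, g.transpose_mul, Matrix.vecMul_one]

/-- The determinant of three vectors. If `x`, `y`, `z` lie on the boundary of `D` and close to
each other, it is positive if and only if `x → y → z` is a counterclockwise turn, as seen from
outside `D`. -/
noncomputable def vol (x y z : Fin 3 → ℝ) : ℝ := (Matrix.of ![x, y, z]).det

theorem Icos.vol_smul (g : Icos) (x y z : Fin 3 → ℝ) :
    vol (g.mat *ᵥ x) (g.mat *ᵥ y) (g.mat *ᵥ z) = vol x y z := by
  have : Matrix.of ![g.mat *ᵥ x, g.mat *ᵥ y, g.mat *ᵥ z] = Matrix.of ![x, y, z] * g.matᵀ := by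
    ext i j
    fin_cases i <;> simp [Matrix.mul_apply, Matrix.mulVec, dotProduct, mul_comm]
  rw [vol, this, Matrix.det_mul, Matrix.det_transpose, g.det_mat, mul_one, vol]

instance : MulAction Icos Vertex where
  smul g x := ⟨g.mat *ᵥ x.1, (g.2 x.1).2 x.2⟩
  one_smul x := Subtype.ext (Matrix.one_mulVec x.1)
  mul_smul g h x := Subtype.ext (by
    change (g * h).mat *ᵥ x.1 = g.mat *ᵥ (h.mat *ᵥ x.1)
    rw [Icos.mat_mul, Matrix.mulVec_mulVec])

theorem coe_smul (g : Icos) (x : Vertex) : (g • x).1 = g.mat *ᵥ x.1 := rfl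

theorem smul_anti (g : Icos) (x : Vertex) : g • x.anti = (g • x).anti :=
  Subtype.ext (Matrix.mulVec_neg x.1 g.mat)

/-- Square of the Euclidean distance between two vertices. -/
def distSq (x y : Vertex) : ℝ := (x.1 - y.1) ⬝ᵥ (x.1 - y.1)

theorem distSq_smul (g : Icos) (x y : Vertex) : distSq (g • x) (g • y) = distSq x y := by
  simp only [distSq, coe_smul, ← Matrix.mulVec_sub, g.dot]

theorem distSq_comm (x y : Vertex) : distSq x y = distSq y x := by
  simp only [distSq]
  rw [← neg_sub y.1 x.1, neg_dotProduct_neg]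

theorem distSq_anti (x y : Vertex) : distSq x.anti y.anti = distSq x y := by
  rw [distSq_comm x y]
  simp only [distSq, Vertex.anti]
  congr 1 <;> abel

/-- The set of oriented edges of `D`: ordered pairs of vertices at distance `2 / φ`. -/
abbrev Dart : Type :=
  {p : Vertex × Vertex // distSq p.1 p.2 = (2 / Real.goldenRatio) ^ 2}

noncomputable instance : Fintype Dart := Fintype.ofFinite _

namespace Dart

/-- Initial point of an oriented edge. -/
abbrev ini (p : Dart) : Vertex := p.1.1

/-- End point of an oriented edge. -/
abbrev ter (p : Dart) : Vertex := p.1.2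

/-- Orientation reversal. -/
def rev (p : Dart) : Dart := ⟨(p.ter, p.ini), by rw [distSq_comm]; exact p.2⟩

/-- The antipodal involution `ι` on oriented edges. -/
def anti (p : Dart) : Dart := ⟨(p.ini.anti, p.ter.anti), by rw [distSq_anti]; exact p.2⟩

@[simp] theorem rev_rev (p : Dart) : p.rev.rev = p := rfl

@[simp] theorem anti_anti (p : Dart) : p.anti.anti = p :=
  Subtype.ext (Prod.ext (Vertex.anti_anti _) (Vertex.anti_anti _))

theorem anti_rev (p : Dart) : p.rev.anti = p.anti.rev := rfl

instance : MulAction Icos Dart where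
  smul g p := ⟨(g • p.ini, g • p.ter), by rw [distSq_smul]; exact p.2⟩
  one_smul _ := Subtype.ext (Prod.ext (one_smul _ _) (one_smul _ _))
  mul_smul _ _ _ := Subtype.ext (Prod.ext (mul_smul _ _ _) (mul_smul _ _ _))

theorem ini_smul (g : Icos) (p : Dart) : (g • p).ini = g • p.ini := rfl
theorem ter_smul (g : Icos) (p : Dart) : (g • p).ter = g • p.ter := rfl
theorem rev_smul (g : Icos) (p : Dart) : (g • p).rev = g • p.rev := rfl

theorem anti_smul (g : Icos) (p : Dart) : (g • p).anti = g • p.anti :=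
  Subtype.ext (Prod.ext (smul_anti _ _).symm (smul_anti _ _).symm)

/-- `q` follows `p` on the counterclockwise boundary of a face of `D`: `q` starts where `p` ends,
and turns left there. (The other two oriented edges that start there are `p.rev`, with
determinant `0`, and the one that turns right.) -/
def Follows (p q : Dart) : Prop := q.ini = p.ter ∧ 0 < vol p.ini.1 p.ter.1 q.ter.1

theorem follows_smul (g : Icos) (p q : Dart) : Follows (g • p) (g • q) ↔ Follows p q := by
  simp only [Follows, ini_smul, ter_smul, coe_smul, g.vol_smul, smul_left_cancel_iff]

end Dart

/-! ## The surface `Σ`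

Let `Σ̂` be the truncated dodecahedron without the triangles. An oriented edge `p` of `D` names the
corner (0-cell) of `Σ̂` on that edge near `p.ini`. The oriented 1-cells of `Σ̂` are

* those of edge type, one for each oriented edge `p` of `D`; it runs from the corner `p` to
  the corner `p.rev`;
* those of truncation type, one for each pair `(p, q)` of distinct oriented edges of `D` with the
  same initial point `x`; it runs from the corner `p` to the corner `q` on the triangle at `x`.

`Σ` is obtained from `Σ̂` by identifying each point of its boundary (the union of the triangles)
with its antipode. So the 0-cells `p` and `ι p` become one, the oriented 1-cells `(p, q)` and
`(ι p, ι q)` of truncation type become one, and nothing else is identified. -/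

/-- Oriented 1-cells of truncation type of `Σ̂`. -/
abbrev Side : Type := {s : Dart × Dart // s.1.ini = s.2.ini ∧ s.1 ≠ s.2}

noncomputable instance : Fintype Side := Fintype.ofFinite _

namespace Side

/-- Orientation reversal. -/
def rev (s : Side) : Side := ⟨(s.1.2, s.1.1), s.2.1.symm, s.2.2.symm⟩

/-- The antipodal involution. -/
def anti (s : Side) : Side :=
  ⟨(s.1.1.anti, s.1.2.anti), congrArg Vertex.anti s.2.1, fun h => s.2.2 (by
    have := congrArg Dart.anti h
    rwa [Dart.anti_anti, Dart.anti_anti] at this)⟩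

@[simp] theorem anti_anti (s : Side) : s.anti.anti = s :=
  Subtype.ext (Prod.ext (Dart.anti_anti _) (Dart.anti_anti _))

@[simp] theorem rev_rev (s : Side) : s.rev.rev = s := rfl

theorem anti_rev (s : Side) : s.rev.anti = s.anti.rev := rfl

instance : MulAction Icos Side where
  smul g s := ⟨(g • s.1.1, g • s.1.2), congrArg (g • ·) s.2.1, fun h => s.2.2
    (smul_left_cancel g h)⟩
  one_smul _ := Subtype.ext (Prod.ext (one_smul _ _) (one_smul _ _))
  mul_smul _ _ _ := Subtype.ext (Prod.ext (mul_smul _ _ _) (mul_smul _ _ _))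

theorem fst_smul (g : Icos) (s : Side) : (g • s).1.1 = g • s.1.1 := rfl
theorem snd_smul (g : Icos) (s : Side) : (g • s).1.2 = g • s.1.2 := rfl
theorem rev_smul (g : Icos) (s : Side) : (g • s).rev = g • s.rev := rfl

theorem anti_smul (g : Icos) (s : Side) : (g • s).anti = g • s.anti :=
  Subtype.ext (Prod.ext (Dart.anti_smul _ _) (Dart.anti_smul _ _))

end Side

/-! ## Modules over the integral group ring -/

/-- The integral group ring of the icosahedral group. -/
abbrev ZI : Type := MonoidAlgebra ℤ Icos

section Perm

variable (X Y : Type) [MulAction Icos X] [MulAction Icos Y]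

/-- The action of the icosahedral group on integer valued functions on `X`,
`(g c) x = c (g⁻¹ x)`. For finite `X` this is the permutation representation `ℤ^X`. -/
noncomputable def permRep : Representation ℤ Icos (X → ℤ) where
  toFun g :=
    { toFun := fun c x => c (g⁻¹ • x)
      map_add' := fun _ _ => rfl
      map_smul' := fun _ _ => rfl }
  map_one' := by ext c x; simp
  map_mul' g h := by
    refine LinearMap.ext fun c => funext fun x => ?_
    change c ((g * h)⁻¹ • x) = c (h⁻¹ • (g⁻¹ • x))
    rw [mul_inv_rev, mul_smul]

/-- `ℤ^X` as a module over the integral group ring. -/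
def Fn : Type := (permRep X).asModule

noncomputable instance : AddCommGroup (Fn X) := inferInstanceAs (AddCommGroup (X → ℤ))

noncomputable instance : Module ZI (Fn X) := inferInstanceAs (Module ZI (permRep X).asModule)

variable {X Y}

/-- View a function as an element of the module `ℤ^X`. -/
noncomputable def Fn.mk (c : X → ℤ) : Fn X := (permRep X).asModuleEquiv.symm c

/-- The value of an element of `ℤ^X` at a point of `X`. -/
noncomputable def Fn.val (c : Fn X) : X → ℤ := (permRep X).asModuleEquiv c

theorem permRep_apply (g : Icos) (c : X → ℤ) (x : X) : permRep X g c x = c (g⁻¹ • x) := rfl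

theorem of_smul (g : Icos) (c : Fn X) : MonoidAlgebra.of ℤ Icos g • c = Fn.mk (permRep X g c.val) :=
  ((permRep X).asModuleEquiv_symm_map_rho g c).symm

/-- A group of functions that is stable under the icosahedral group, as a submodule of `ℤ^X`. -/
noncomputable def stable (W : Submodule ℤ (X → ℤ)) (h : ∀ g, ∀ c ∈ W, permRep X g c ∈ W) :
    Submodule ZI (Fn X) :=
  MonoidAlgebra.submoduleOfSMulMem (S := ℤ) (M := Icos) (V := Fn X)
    (W.comap (permRep X).asModuleEquiv.toLinearMap) (fun g c hc => by
      rw [of_smul]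
      exact h g _ hc)

theorem permRep_comm_of_smul (f : (X → ℤ) →ₗ[ℤ] (Y → ℤ))
    (h : ∀ g c, f (permRep X g c) = permRep Y g (f c)) (g : Icos) (c : (permRep X).asModule) :
    f (MonoidAlgebra.single g (1 : ℤ) • c : (permRep X).asModule) =
      MonoidAlgebra.single g (1 : ℤ) • (show (permRep Y).asModule from f c) := by
  have h1 := (permRep X).asModuleEquiv_symm_map_rho g c
  have h2 := (permRep Y).asModuleEquiv_symm_map_rho g (f c)
  rw [MonoidAlgebra.of_apply] at h1 h2
  exact ((congrArg f h1).symm.trans (h g c)).trans h2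

/-- Auxiliary version of `equivariant`. -/
noncomputable def equivariantAux (f : (X → ℤ) →ₗ[ℤ] (Y → ℤ))
    (h : ∀ g c, f (permRep X g c) = permRep Y g (f c)) :
    (permRep X).asModule →ₗ[MonoidAlgebra ℤ Icos] (permRep Y).asModule :=
  MonoidAlgebra.equivariantOfLinearOfComm
    (V := (permRep X).asModule) (W := (permRep Y).asModule)
    ((permRep Y).asModuleEquiv.symm.toLinearMap ∘ₗ f ∘ₗ (permRep X).asModuleEquiv.toLinearMap)
    (permRep_comm_of_smul f h)

/-- An equivariant homomorphism `ℤ^X → ℤ^Y`, as a linear map over the integral group ring. -/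
noncomputable def equivariant (f : (X → ℤ) →ₗ[ℤ] (Y → ℤ))
    (h : ∀ g c, f (permRep X g c) = permRep Y g (f c)) : Fn X →ₗ[ZI] Fn Y :=
  equivariantAux f h

end Perm

/-! ## The cellular chain complex `0 → C₂ → C₁ → C₀ → 0` of `Σ`

A 0-chain of `Σ` is given by its coefficients at the 0-cells; a 1-chain by its coefficients at the
oriented 1-cells, where the coefficient changes sign when the orientation is reversed (so that a
cell with the opposite orientation is the opposite chain); a 2-chain by its coefficients at
the faces, with their counterclockwise orientations. -/

/-- 0-chains: functions on the corners of `Σ̂` that take the same value at antipodal corners. -/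
noncomputable def C0 : Submodule ZI (Fn Dart) :=
  stable
    { carrier := {c | ∀ p, c p.anti = c p}
      add_mem' := fun ha hb p => congrArg₂ (· + ·) (ha p) (hb p)
      zero_mem' := fun _ => rfl
      smul_mem' := fun n _ hc p => congrArg (n • ·) (hc p) }
    (fun g c hc p => by
      rw [permRep_apply, permRep_apply, ← Dart.anti_smul]
      exact hc _)

/-- 1-chains of edge type; the oriented 1-cell of edge type `p` has the opposite `p.rev`. -/
noncomputable def CEdge : Submodule ZI (Fn Dart) :=
  stable
    { carrier := {c | ∀ p, c p.rev = -c p}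
      add_mem' := fun {a b} ha hb p => by
        change a p.rev + b p.rev = -(a p + b p)
        rw [ha p, hb p, neg_add]
      zero_mem' := fun _ => rfl
      smul_mem' := fun n c hc p => by
        change n • c p.rev = -(n • c p)
        rw [hc p, smul_neg] }
    (fun g c hc p => by
      rw [permRep_apply, permRep_apply, ← Dart.rev_smul]
      exact hc _)

/-- 1-chains of truncation type; antipodal cells `s` and `s.anti` are the same cell of `Σ`. -/
noncomputable def CTrc : Submodule ZI (Fn Side) :=
  stable
    { carrier := {c | (∀ s, c s.rev = -c s) ∧ ∀ s, c s.anti = c s}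
      add_mem' := fun {a b} ha hb => ⟨fun s => by
        change a s.rev + b s.rev = -(a s + b s)
        rw [ha.1 s, hb.1 s, neg_add], fun s => congrArg₂ (· + ·) (ha.2 s) (hb.2 s)⟩
      zero_mem' := ⟨fun _ => rfl, fun _ => rfl⟩
      smul_mem' := fun n c hc => ⟨fun s => by
        change n • c s.rev = -(n • c s)
        rw [hc.1 s, smul_neg], fun s => congrArg (n • ·) (hc.2 s)⟩ }
    (fun g c hc => ⟨fun s => by
      rw [permRep_apply, permRep_apply, ← Side.rev_smul]
      exact hc.1 _, fun s => by
      rw [permRep_apply, permRep_apply, ← Side.anti_smul]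
      exact hc.2 _⟩)

/-- All 1-chains: `C₁` is the direct sum of `C_edge` and `C_trc`. -/
def C1 : Type := CEdge × CTrc

noncomputable instance : AddCommGroup C1 := inferInstanceAs (AddCommGroup (CEdge × CTrc))

noncomputable instance : Module ZI C1 := inferInstanceAs (Module ZI (CEdge × CTrc))

/-- 2-chains. A face of `D` (equivalently, of `Σ`) is given by the oriented edges of its
counterclockwise boundary, and each oriented edge lies on the counterclockwise boundary of exactly
one face, the one on its left. So a function on the set of faces is a function on the set of
oriented edges which takes the same value at `p` and at `q` whenever `q` follows `p` on
the counterclockwise boundary of a face. -/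
noncomputable def C2 : Submodule ZI (Fn Dart) :=
  stable
    { carrier := {c | ∀ p q, Dart.Follows p q → c p = c q}
      add_mem' := fun ha hb p q h => congrArg₂ (· + ·) (ha p q h) (hb p q h)
      zero_mem' := fun _ _ _ => rfl
      smul_mem' := fun n _ hc p q h => congrArg (n • ·) (hc p q h) }
    (fun g c hc p q h => by
      rw [permRep_apply, permRep_apply]
      exact hc _ _ ((Dart.follows_smul _ _ _).2 h))

/-- The boundary of a 1-chain of edge type. Its coefficient at a 0-cell is the sum of
the coefficients of the oriented 1-cells that end there. Those of edge type ending at the 0-cell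
`{p, ι p}` are `p.rev` and `(ι p).rev`. -/
noncomputable def boundaryEdge : CEdge →ₗ[ZI] C0 :=
  (equivariant (X := Dart) (Y := Dart)
    { toFun := fun c p => c p.rev + c p.anti.rev
      map_add' := fun a b => funext fun p => add_add_add_comm _ _ _ _
      map_smul' := fun n a => funext fun p => (smul_add n _ _).symm }
    (fun g c => funext fun p => by
      simp only [LinearMap.coe_mk, AddHom.coe_mk, permRep_apply, Dart.anti_smul,
        Dart.rev_smul])).restrict
  (fun c _ p => by
    change c.val p.anti.rev + c.val p.anti.anti.rev = c.val p.rev + c.val p.anti.rev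
    rw [Dart.anti_anti, add_comm])

open Classical in
/-- The boundary of a 1-chain of truncation type. Those 1-cells of truncation type that end at
the 0-cell `{p, ι p}` are the pairs `(q, p)` (which are identified with the pairs
`(ι q, ι p)`). -/
noncomputable def boundaryTrc : CTrc →ₗ[ZI] C0 :=
  (equivariant (X := Side) (Y := Dart)
    { toFun := fun c p => ∑ s : Side, if s.1.2 = p then c s else 0
      map_add' := fun a b => funext fun p => by
        simp only [Pi.add_apply, ← Finset.sum_add_distrib]
        exact Finset.sum_congr rfl fun s _ => by split_ifs <;> simp
      map_smul' := fun n a => funext fun p => by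
        simp only [Pi.smul_apply, Finset.smul_sum, RingHom.id_apply]
        exact Finset.sum_congr rfl fun s _ => by split_ifs <;> simp }
    (fun g c => funext fun p => by
      simp only [LinearMap.coe_mk, AddHom.coe_mk, permRep_apply]
      refine Fintype.sum_equiv (MulAction.toPerm g⁻¹) _ _ fun s => ?_
      have : (MulAction.toPerm g⁻¹ s : Side).1.2 = g⁻¹ • p ↔ s.1.2 = p :=
        smul_left_cancel_iff g⁻¹
      exact if_congr this.symm rfl rfl)).restrict
  (fun c hc p => by
    change (∑ s : Side, if s.1.2 = p.anti then c.val s else 0) =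
      ∑ s : Side, if s.1.2 = p then c.val s else 0
    refine Fintype.sum_equiv (Function.Involutive.toPerm Side.anti Side.anti_anti) _ _ fun s => ?_
    have h1 : (Function.Involutive.toPerm Side.anti Side.anti_anti s).1.2 = p ↔
        s.1.2 = p.anti := by
      change s.1.2.anti = p ↔ _
      constructor
      · rintro rfl
        exact (Dart.anti_anti _).symm
      · intro h
        rw [h, Dart.anti_anti]
    have h2 : c.val (Function.Involutive.toPerm Side.anti Side.anti_anti s) = c.val s := hc.2 s
    simp only [h1, h2])

/-- The boundary map `∂₁ : C₁ → C₀`. -/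
noncomputable def boundary1 : C1 →ₗ[ZI] C0 :=
  (boundaryEdge.coprod boundaryTrc : CEdge × CTrc →ₗ[ZI] C0)

/-- The edge type part of the boundary of a 2-chain: the cell `p` of edge type occurs in
the boundary of the face on its left with sign `1`, of the face on its right with sign `-1`. -/
noncomputable def boundaryFaceEdge : C2 →ₗ[ZI] CEdge :=
  (equivariant (X := Dart) (Y := Dart)
    { toFun := fun c p => c p - c p.rev
      map_add' := fun a b => funext fun p => add_sub_add_comm _ _ _ _
      map_smul' := fun n a => funext fun p => (smul_sub n _ _).symm }
    (fun g c => funext fun p => by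
      simp only [LinearMap.coe_mk, AddHom.coe_mk, permRep_apply, Dart.rev_smul])).restrict
  (fun c _ p => (neg_sub (c.val p) (c.val p.rev)).symm)

open Classical in
/-- The coefficient of the truncation type cell `s = (p, q)` of `Σ̂` in the boundary in `Σ̂` of
a 2-chain. Only one face of `Σ̂` has this cell in its boundary; if `q` follows `p.rev` on
the counterclockwise boundary of that face of `D`, then the counterclockwise boundary of
the truncated face goes along `p.rev` to the corner `p`, on to the corner `q`, and then along `q`,
so that the sign is `1`; if `p` follows `q.rev`, then the sign is `-1`. -/
noncomputable def faceCoeff (c : Dart → ℤ) (s : Side) : ℤ :=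
  (if Dart.Follows s.1.1.rev s.1.2 then c s.1.2 else 0) -
    (if Dart.Follows s.1.2.rev s.1.1 then c s.1.1 else 0)

theorem faceCoeff_rev (c : Dart → ℤ) (s : Side) : faceCoeff c s.rev = -faceCoeff c s :=
  (neg_sub _ _).symm

theorem faceCoeff_add (a b : Dart → ℤ) (s : Side) :
    faceCoeff (a + b) s = faceCoeff a s + faceCoeff b s := by
  simp only [faceCoeff, Pi.add_apply]
  split_ifs <;> ring

theorem faceCoeff_smul (n : ℤ) (a : Dart → ℤ) (s : Side) :
    faceCoeff (n • a) s = n • faceCoeff a s := by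
  simp only [faceCoeff, Pi.smul_apply, smul_eq_mul]
  split_ifs <;> ring

theorem faceCoeff_permRep (g : Icos) (c : Dart → ℤ) (s : Side) :
    faceCoeff (permRep Dart g c) s = faceCoeff c (g⁻¹ • s) := by
  classical
  have h1 : Dart.Follows (g⁻¹ • s).1.1.rev (g⁻¹ • s).1.2 ↔ Dart.Follows s.1.1.rev s.1.2 :=
    Dart.follows_smul g⁻¹ s.1.1.rev s.1.2
  have h2 : Dart.Follows (g⁻¹ • s).1.2.rev (g⁻¹ • s).1.1 ↔ Dart.Follows s.1.2.rev s.1.1 :=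
    Dart.follows_smul g⁻¹ s.1.2.rev s.1.1
  exact congrArg₂ (· - ·) (if_congr h1.symm rfl rfl) (if_congr h2.symm rfl rfl)

/-- The truncation type part of the boundary of a 2-chain: each cell of truncation type of `Σ` is
represented by two antipodal cells of `Σ̂`. -/
noncomputable def boundaryFaceTrc : C2 →ₗ[ZI] CTrc :=
  (equivariant (X := Dart) (Y := Side)
    { toFun := fun c s => faceCoeff c s + faceCoeff c s.anti
      map_add' := fun a b => funext fun s => by
        simp only [faceCoeff_add, Pi.add_apply]
        ring
      map_smul' := fun n a => funext fun s => by
        simp only [faceCoeff_smul, Pi.smul_apply, smul_add, RingHom.id_apply] }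
    (fun g c => funext fun s => by
      simp only [LinearMap.coe_mk, AddHom.coe_mk, permRep_apply, faceCoeff_permRep,
        Side.anti_smul])).restrict
  (fun c _ => ⟨fun s => by
    change faceCoeff c.val s.rev + faceCoeff c.val s.anti.rev =
      -(faceCoeff c.val s + faceCoeff c.val s.anti)
    rw [faceCoeff_rev, faceCoeff_rev, neg_add], fun s => by
    change faceCoeff c.val s.anti + faceCoeff c.val s.anti.anti =
      faceCoeff c.val s + faceCoeff c.val s.anti
    rw [Side.anti_anti, add_comm]⟩)

/-- The boundary map `∂₂ : C₂ → C₁`. -/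
noncomputable def boundary2 : C2 →ₗ[ZI] C1 :=
  (boundaryFaceEdge.prod boundaryFaceTrc : C2 →ₗ[ZI] CEdge × CTrc)

/-- The 1-cycles. -/
noncomputable abbrev Z1 : Submodule ZI C1 := LinearMap.ker boundary1

/-- The 1-boundaries. -/
noncomputable abbrev B1 : Submodule ZI C1 := LinearMap.range boundary2

/-- The first homology group `H₁(Σ) = Z₁ / B₁`. -/
def H1 : Type := Z1 ⧸ B1.submoduleOf Z1

noncomputable instance : AddCommGroup H1 := inferInstanceAs (AddCommGroup (Z1 ⧸ B1.submoduleOf Z1))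

noncomputable instance : Module ZI H1 := inferInstanceAs (Module ZI (Z1 ⧸ B1.submoduleOf Z1))

/-- The projection `p : Z₁ → H₁(Σ)`. -/
noncomputable def toH1 : Z1 →ₗ[ZI] H1 := (B1.submoduleOf Z1).mkQ

/-! ## Inscribed cubes and the module `V_o` -/

/-- `S` is the set of vertices of a cube which is inscribed in `D`: the eight points
`±a ± b ± c`, for pairwise orthogonal `a`, `b`, `c` of equal length, are vertices of `D`, and
`S` consists of them. (A cube whose vertices are vertices of `D` has the same
circumscribed sphere as `D`, so it is centered at the origin.) -/
def IsInscribedCube (S : Set Vertex) : Prop :=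
  ∃ a b c : Fin 3 → ℝ, a ⬝ᵥ b = 0 ∧ b ⬝ᵥ c = 0 ∧ a ⬝ᵥ c = 0 ∧ a ⬝ᵥ a = b ⬝ᵥ b ∧
    b ⬝ᵥ b = c ⬝ᵥ c ∧
    Subtype.val '' S = {y | ∃ i j k : ℤˣ, y = i • a + j • b + k • c}

/-- The set of inscribed cubes. -/
abbrev Cube : Type := {S : Set Vertex // IsInscribedCube S}

theorem IsInscribedCube.image {S : Set Vertex} (h : IsInscribedCube S) (g : Icos) :
    IsInscribedCube ((g • ·) '' S) := by
  obtain ⟨a, b, c, h1, h2, h3, h4, h5, hS⟩ := h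
  refine ⟨g.mat *ᵥ a, g.mat *ᵥ b, g.mat *ᵥ c, ?_⟩
  refine ⟨by rwa [g.dot], by rwa [g.dot], by rwa [g.dot], by rwa [g.dot, g.dot],
    by rwa [g.dot, g.dot], ?_⟩
  have : Subtype.val '' ((g • ·) '' S) = (g.mat *ᵥ ·) '' (Subtype.val '' S) := by
    rw [Set.image_image, Set.image_image]
    rfl
  rw [this, hS]
  have key : ∀ i j k : ℤˣ, g.mat *ᵥ (i • a + j • b + k • c) =
      i • (g.mat *ᵥ a) + j • (g.mat *ᵥ b) + k • (g.mat *ᵥ c) := fun i j k => by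
    simp only [Matrix.mulVec_add, Units.smul_def, Matrix.mulVec_smul]
  ext y
  constructor
  · rintro ⟨_, ⟨i, j, k, rfl⟩, rfl⟩
    exact ⟨i, j, k, key i j k⟩
  · rintro ⟨i, j, k, rfl⟩
    exact ⟨_, ⟨i, j, k, rfl⟩, key i j k⟩

instance : MulAction Icos Cube where
  smul g e := ⟨(g • ·) '' e.1, e.2.image g⟩
  one_smul e := Subtype.ext (by
    change (fun x : Vertex => (1 : Icos) • x) '' e.1 = e.1
    simp)
  mul_smul g h e := Subtype.ext (by
    change (fun x : Vertex => (g * h) • x) '' e.1 =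
      (fun x : Vertex => g • x) '' ((fun x : Vertex => h • x) '' e.1)
    rw [Set.image_image]
    simp only [mul_smul])

/-- The main diagonal in `ℤ^K`, where `K` is the set of inscribed cubes. -/
noncomputable def diagonal : Submodule ZI (Fn Cube) :=
  stable
    { carrier := {c | ∀ e e', c e = c e'}
      add_mem' := fun ha hb e e' => congrArg₂ (· + ·) (ha e e') (hb e e')
      zero_mem' := fun _ _ => rfl
      smul_mem' := fun n _ hc e e' => congrArg (n • ·) (hc e e') }
    (fun _ _ hc _ _ => hc _ _)

/-- The integral form `V_o` of the reflection representation: `ℤ^K` modulo its main diagonal. -/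
def Vo : Type := Fn Cube ⧸ diagonal

noncomputable instance : AddCommGroup Vo := inferInstanceAs (AddCommGroup (Fn Cube ⧸ diagonal))

noncomputable instance : Module ZI Vo := inferInstanceAs (Module ZI (Fn Cube ⧸ diagonal))

/-- The projection `ℤ^K → V_o`. -/
noncomputable def toVo : Fn Cube →ₗ[ZI] Vo := diagonal.mkQ

open Classical in
/-- The image in `V_o` of the basis vector of `ℤ^K` that belongs to the cube `e`. -/
noncomputable def Cube.bar (e : Cube) : Vo := toVo (Fn.mk (Pi.single e 1))

/-- `E` is one of the two halves of the vertex set of the cube `e`: this set is the disjoint union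
of `E` and its antipode, and no two elements of `E` span an edge of the cube. (The cube lies on
a sphere with radius `√3`, so its edges have length `2`.) -/
def Cube.IsHalf (e : Cube) (E : Set Vertex) : Prop :=
  E ∪ Vertex.anti '' E = e.1 ∧ Disjoint E (Vertex.anti '' E) ∧
    ∀ x ∈ E, ∀ y ∈ E, distSq x y ≠ 4

/-- There is an inscribed cube with such a half: the cube with the vertices `(±1, ±1, ±1)`. -/
theorem exists_isHalf : ∃ (e : Cube) (E : Set Vertex), e.IsHalf E := by
  have hu : ∀ i : ℤˣ, i = 1 ∨ i = -1 := Int.units_eq_one_or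
  have key : ∀ t : ℝ, |t| = 1 ↔ t = 1 ∨ t = -1 := fun t => by
    rw [abs_eq (by norm_num)]
  refine ⟨⟨{x | ∀ i, |x.1 i| = 1}, ![1,0,0], ![0,1,0], ![0,0,1], by simp, by simp, by simp,
    by simp, by simp, ?_⟩, {x | (∀ i, |x.1 i| = 1) ∧ x.1 0 * x.1 1 * x.1 2 = 1}, ?_, ?_, ?_⟩
  · ext y
    have hy : (∃ i j k : ℤˣ, y = i • ![1,0,0] + j • ![0,1,0] + k • ![0,0,1]) ↔ ∀ i, |y i| = 1 := by
      constructor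
      · rintro ⟨i, j, k, rfl⟩
        rcases hu i with rfl | rfl <;> rcases hu j with rfl | rfl <;> rcases hu k with rfl | rfl <;>
          simp [Fin.forall_fin_succ, Units.smul_def]
      · intro h
        have h' : ∀ i, ∃ u : ℤˣ, y i = ((u : ℤ) : ℝ) := fun i => by
          rcases (key _).1 (h i) with h | h
          · exact ⟨1, by simp [h]⟩
          · exact ⟨-1, by simp [h]⟩
        choose u hu' using h'
        refine ⟨u 0, u 1, u 2, ?_⟩
        ext l
        fin_cases l <;> simp [Units.smul_def, hu']
    constructor
    · rintro ⟨x, hx, rfl⟩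
      exact hy.2 hx
    · intro h
      exact ⟨⟨y, Or.inl (hy.1 h)⟩, hy.1 h, rfl⟩
  · ext x
    simp only [Set.mem_union, Set.mem_image, Set.mem_ofPred_eq]
    constructor
    · rintro (h | ⟨z, h, rfl⟩)
      · exact h.1
      · intro i
        simpa [Vertex.anti] using h.1 i
    · intro h
      by_cases h1 : x.1 0 * x.1 1 * x.1 2 = 1
      · exact Or.inl ⟨h, h1⟩
      · refine Or.inr ⟨x.anti, ⟨fun i => by simpa [Vertex.anti] using h i, ?_⟩, by simp⟩
        simp only [Vertex.anti, Pi.neg_apply]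
        rcases (key _).1 (h 0) with a | a <;> rcases (key _).1 (h 1) with b | b <;>
          rcases (key _).1 (h 2) with c | c <;> rw [a, b, c] at h1 ⊢ <;> revert h1 <;> norm_num
  · rw [Set.disjoint_left]
    rintro x h ⟨z, hz, rfl⟩
    have h1 := h.2
    have h2 := hz.2
    simp only [Vertex.anti, Pi.neg_apply] at h1
    nlinarith
  · rintro x ⟨hx, hx1⟩ y ⟨hy, hy1⟩ hd
    simp only [distSq, dotProduct, Fin.sum_univ_three, Pi.sub_apply] at hd
    rcases (key _).1 (hx 0) with a | a <;> rcases (key _).1 (hx 1) with b | b <;>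
      rcases (key _).1 (hx 2) with c | c <;> rcases (key _).1 (hy 0) with a' | a' <;>
      rcases (key _).1 (hy 1) with b' | b' <;> rcases (key _).1 (hy 2) with c' | c' <;>
      rw [a, b, c] at hx1 <;> rw [a', b', c'] at hy1 <;> rw [a, b, c, a', b', c'] at hd <;>
      revert hx1 hy1 hd <;> norm_num

/-! ## The homomorphisms -/

open Classical in
/-- The oriented 1-cell of edge type `p`, as a 1-chain. -/
noncomputable def edgeCell (p : Dart) : CEdge :=
  ⟨Fn.mk (Pi.single p 1 - Pi.single p.rev 1), fun q => by
    change (Pi.single p 1 - Pi.single p.rev 1 : Dart → ℤ) q.rev =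
      -(Pi.single p 1 - Pi.single p.rev 1 : Dart → ℤ) q
    have h1 : q.rev = p ↔ q = p.rev := ⟨fun h => h ▸ rfl, fun h => h ▸ rfl⟩
    have h2 : q.rev = p.rev ↔ q = p := ⟨fun h => congrArg Dart.rev h, fun h => h ▸ rfl⟩
    simp only [Pi.sub_apply, Pi.single_apply, h1, h2, neg_sub]⟩

open Classical in
/-- The oriented 1-cell of `Σ` of truncation type represented by `s`, as a 1-chain. -/
noncomputable def sideCell (s : Side) : CTrc :=
  ⟨Fn.mk (Pi.single s 1 + Pi.single s.anti 1 - Pi.single s.rev 1 - Pi.single s.anti.rev 1), by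
    have hr : ∀ t u : Side, t.rev = u ↔ t = u.rev := fun t u =>
      ⟨fun h => h ▸ rfl, fun h => h ▸ rfl⟩
    have ha : ∀ t u : Side, t.anti = u ↔ t = u.anti := fun t u =>
      ⟨fun h => h ▸ (Side.anti_anti t).symm, fun h => h ▸ Side.anti_anti u⟩
    constructor
    · intro t
      change (Pi.single s 1 + Pi.single s.anti 1 - Pi.single s.rev 1 - Pi.single s.anti.rev 1 :
        Side → ℤ) t.rev = -(Pi.single s 1 + Pi.single s.anti 1 - Pi.single s.rev 1 -
          Pi.single s.anti.rev 1 : Side → ℤ) t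
      simp only [Pi.sub_apply, Pi.add_apply, Pi.single_apply, hr, Side.rev_rev]
      ring
    · intro t
      change (Pi.single s 1 + Pi.single s.anti 1 - Pi.single s.rev 1 - Pi.single s.anti.rev 1 :
        Side → ℤ) t.anti = (Pi.single s 1 + Pi.single s.anti 1 - Pi.single s.rev 1 -
          Pi.single s.anti.rev 1 : Side → ℤ) t
      simp only [Pi.sub_apply, Pi.add_apply, Pi.single_apply, ha, Side.anti_anti,
        Side.anti_rev]
      ring⟩

open Classical in
/-- The loop of truncation type `δ_x`: the boundary, with its counterclockwise orientation, of
the triangle at the vertex `x`. -/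
noncomputable def loopTrc (x : Vertex) : CTrc :=
  ∑ s : Side with s.1.1.ini = x ∧ 0 < vol x.1 s.1.1.ter.1 s.1.2.ter.1, sideCell s

/-- The loop of edge type `δ_y`: it goes along `y`, and returns along the antipode of `y`. -/
noncomputable def loopEdge (y : Dart) : CEdge := edgeCell y - edgeCell y.anti

open Classical in
/-- `δ^E_trc`, the sum of the loops of truncation type `δ_x` for `x ∈ E`. -/
noncomputable def deltaTrc (E : Set Vertex) : C1 := (0, ∑ x : Vertex with x ∈ E, loopTrc x)

open Classical in
/-- `δ^E_edge`, the sum of the loops of edge type `δ_y` over the oriented edges `y` with initial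
point in `E`. -/
noncomputable def deltaEdge (E : Set Vertex) : C1 :=
  (∑ x : Vertex with x ∈ E, ∑ y : Dart with y.ini = x, loopEdge y, 0)

/-- The map `p_* : Hom(V_o, Z₁) → Hom(V_o, H₁(Σ))` induced by `p`. -/
noncomputable def pStar : (Vo →ₗ[ZI] Z1) →+ (Vo →ₗ[ZI] H1) where
  toFun f := toH1 ∘ₗ f
  map_zero' := LinearMap.comp_zero _
  map_add' f g := LinearMap.comp_add f g _

/-- The cokernel of `p_*`. -/
abbrev CokerPStar : Type := (Vo →ₗ[ZI] H1) ⧸ AddMonoidHom.range (G := Vo →ₗ[ZI] Z1) pStar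

end Dodec

/-!
The proof reduces everything to cycles that are invariant under the stabilizer `A₄` of one
inscribed cube, and to two linear functionals on the homology.

*Reduction to one cube.* The icosahedral group permutes the five inscribed cubes transitively
(`exists_smul_baseCube`), so `V_o` is generated, as a module over the group ring, by the image of
the standard cube with vertices `(±1, ±1, ±1)` (`span_bar`). A homomorphism from `V_o` is
determined by the image of this generator, which is invariant under the stabilizer. Conversely, an
equivariant family of cycles indexed by the cubes defines a homomorphism as soon as its sum
vanishes (`exists_hom`); this is automatic, since `Z₁` has no nonzero element that is invariant
under the whole group (`eq_zero_of_invariant`). The chirality of `D` singles out one half of each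
cube in an invariant manner (`Cube.half`), which makes the cycles `δ^E_trc` and `δ^E_edge` for
this choice of halves into such families; the other half only changes the sign.

*Invariant cycles.* In terms of the function `s` on vertices that is `1` on `E`, `-1` on `ι E` and
`0` elsewhere, the chain `δ^E_trc` has the coefficient `s x` on each side of the triangle at `x`,
and `δ^E_edge` has the coefficient `s x - s y` on the edge from `x` to `y`. An orbit by orbit
inspection shows that these two span the cycles that are invariant under the stabilizer
(`StabInvariant.eq_smul_add_smul`). Two functionals that vanish on boundaries, `crossTrc` and
`crossEdge`, take the values `1, 0` and `0, 3` on them. Hence `Hom(V_o, Z₁)` has the asserted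
basis, and `Hom(V_o, B₁) = 0`.

*Homology.* The group `H₁(Σ)` is torsion free (`H1_eq_zero_of_zsmul`), because `∂ c ≡ 0` modulo
`n` forces the function `c` on faces to be constant modulo `n`. Colouring each face by the
coordinate that vanishes on its normal shows that `δ^E_edge` is a boundary modulo `3`, whence the
homomorphism `w` with `3 w = p_* u_edge` (`exists_three_zsmul_hom_eq`). Averaging over the
stabilizer lifts a nonzero multiple of any `f ∈ Hom(V_o, H₁(Σ))` to `Z₁`. As the functionals take
the values `1, 0` and `0, 1` on `p_* u_trc` and `w`, and as there is no torsion, `f` is the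
integral combination of these two whose coefficients are its values under the functionals
(`hom_H1_eq`).

Incidences are checked by computation: the vertices have coordinates in `ℤ[φ]`, and an oriented
edge is numbered by its initial vertex and one of the three neighbours in counterclockwise order.
-/

namespace Dodec

/-! ### Coordinates in the ring of golden integers -/

/-- The ring `ℤ[φ]`, with `φ² = 1 + φ`; the element `⟨a, b⟩` is `a + b φ`. It has computable
arithmetic, so that facts about the coordinates of the vertices can be decided. -/
abbrev GoldenInt : Type := QuadraticAlgebra ℤ 1 1

/-- The embedding `ℤ[φ] → ℝ`. -/
noncomputable def toReal : GoldenInt →+* ℝ where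
  toFun z := z.re + z.im * Real.goldenRatio
  map_zero' := by simp
  map_one' := by
    simp [show (1 : GoldenInt).re = 1 from rfl, show (1 : GoldenInt).im = 0 from rfl]
  map_add' z w := by
    simp only [QuadraticAlgebra.re_add, QuadraticAlgebra.im_add, Int.cast_add]
    ring
  map_mul' z w := by
    simp only [QuadraticAlgebra.re_mul, QuadraticAlgebra.im_mul, Int.cast_add, Int.cast_mul,
      Int.cast_one]
    linear_combination (-(z.im * w.im : ℝ)) * Real.goldenRatio_sq

theorem toReal_apply (z : GoldenInt) : toReal z = z.re + z.im * Real.goldenRatio := rfl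

theorem toReal_injective : Function.Injective toReal := by
  rw [injective_iff_map_eq_zero]
  intro z hz
  rw [toReal_apply] at hz
  have him : z.im = 0 := by
    by_contra h
    have h' : (z.im : ℝ) ≠ 0 := by exact_mod_cast h
    refine Real.goldenRatio_irrational ⟨-z.re / z.im, ?_⟩
    push_cast
    rw [div_eq_iff h']
    linarith
  have hre : (z.re : ℝ) = 0 := by simpa [him] using hz
  exact QuadraticAlgebra.ext (by exact_mod_cast hre) him

theorem toReal_inv_phi : toReal ⟨-1, 1⟩ = Real.goldenRatio⁻¹ := by
  rw [Real.inv_goldenRatio, toReal_apply, ← Real.one_sub_goldenConj]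
  have := Real.goldenRatio_add_goldenConj
  push_cast
  linarith

theorem toReal_phi : toReal ⟨0, 1⟩ = Real.goldenRatio := by simp [toReal_apply]

/-- Coordinates of the twenty vertices. The numbering is by the combinatorial distance from vertex
`0`, and the antipode of the vertex `v` is `v.rev`. -/
def coord : Fin 20 → Fin 3 → GoldenInt :=
  let o : GoldenInt := ⟨1, 0⟩
  let f : GoldenInt := ⟨0, 1⟩
  let i : GoldenInt := ⟨-1, 1⟩
  ![![-o, -o, -o], ![0, -i, -f], ![-i, -f, 0], ![-f, 0, -i], ![o, -o, -o], ![0, i, -f],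
    ![-o, -o, o], ![i, -f, 0], ![-o, o, -o], ![-f, 0, i], ![f, 0, -i], ![o, -o, o],
    ![-i, f, 0], ![o, o, -o], ![0, -i, f], ![-o, o, o], ![f, 0, i], ![i, f, 0],
    ![0, i, f], ![o, o, o]]

/-- The three neighbours of a vertex, in counterclockwise order. -/
def nbr : Fin 20 → Fin 3 → Fin 20 :=
  ![![1, 2, 3], ![4, 0, 5], ![6, 0, 7], ![8, 0, 9], ![1, 10, 7], ![13, 1, 8], ![14, 9, 2],
    ![11, 2, 4], ![5, 3, 12], ![15, 3, 6], ![4, 13, 16], ![14, 7, 16], ![8, 15, 17], ![5, 17, 10],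
    ![6, 11, 18], ![18, 12, 9], ![11, 10, 19], ![13, 12, 19], ![15, 14, 19], ![18, 16, 17]]

/-- The determinant of three vectors over `ℤ[φ]`. -/
def volZ (x y z : Fin 3 → GoldenInt) : GoldenInt :=
  x 0 * y 1 * z 2 - x 0 * y 2 * z 1 - x 1 * y 0 * z 2 + x 1 * y 2 * z 0 +
    x 2 * y 0 * z 1 - x 2 * y 1 * z 0

/-- The scalar product of two vectors over `ℤ[φ]`. -/
def dotZ (x y : Fin 3 → GoldenInt) : GoldenInt := x 0 * y 0 + x 1 * y 1 + x 2 * y 2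

theorem coord_isVertex : ∀ v, (∀ i, coord v i = 1 ∨ coord v i = -1) ∨
    ∃ i, coord v i = 0 ∧ (coord v (i + 1) = ⟨-1, 1⟩ ∨ coord v (i + 1) = -⟨-1, 1⟩) ∧
      (coord v (i + 2) = ⟨0, 1⟩ ∨ coord v (i + 2) = -⟨0, 1⟩) := by
  decide +kernel

theorem coord_injective : Function.Injective coord := by
  have h : ∀ v w, coord v = coord w → v = w := by decide +kernel
  exact fun v w => h v w

theorem coord_surj_cube : ∀ a b c : ℤˣ, ∃ v, coord v = ![⟨a, 0⟩, ⟨b, 0⟩, ⟨c, 0⟩] := by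
  decide +kernel

theorem coord_surj_other : ∀ (i : Fin 3) (a b : ℤˣ), ∃ v, coord v i = 0 ∧
    coord v (i + 1) = ⟨-a, a⟩ ∧ coord v (i + 2) = ⟨0, b⟩ := by
  decide +kernel

theorem coord_rev : ∀ v i, coord v.rev i = -coord v i := by decide +kernel

theorem distZ_eq_iff : ∀ v w, dotZ (coord v - coord w) (coord v - coord w) = ⟨8, -4⟩ ↔
    ∃ i, w = nbr v i := by
  decide +kernel

theorem nbr_injective : ∀ v i j, nbr v i = nbr v j → i = j := by decide +kernel

theorem volZ_nbr : ∀ v i,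
    volZ (coord v) (coord (nbr v i)) (coord (nbr v (i + 1))) = 2 := by
  decide +kernel

/-! ### Vertices, edges and the cyclic order at a vertex -/

/-- The vertex with the given number. -/
noncomputable def vert (v : Fin 20) : Vertex :=
  ⟨fun i => toReal (coord v i), by
    rcases coord_isVertex v with h | ⟨i, h0, h1, h2⟩
    · refine Or.inl fun i => ?_
      rcases h i with h | h <;> simp [h]
    · refine Or.inr ⟨i, by simp [h0], ?_, ?_⟩
      · have : 0 < Real.goldenRatio⁻¹ := inv_pos.2 Real.goldenRatio_pos
        rcases h1 with h | h <;> simp only [h, map_neg, abs_neg, toReal_inv_phi, abs_of_pos this]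
      · rcases h2 with h | h <;>
          simp only [h, map_neg, abs_neg, toReal_phi, abs_of_pos Real.goldenRatio_pos]⟩

theorem vert_val (v : Fin 20) : (vert v).1 = fun i => toReal (coord v i) := rfl

theorem vert_injective : Function.Injective vert := fun _ _ h =>
  coord_injective (funext fun i => toReal_injective (congrFun (congrArg Subtype.val h) i))

theorem abs_eq_units_mul {a b : ℝ} (h : |a| = b) : ∃ u : ℤˣ, a = ((u : ℤ) : ℝ) * b := by
  rcases abs_choice a with h' | h' <;> rw [h'] at h
  · exact ⟨1, by simp [h]⟩
  · exact ⟨-1, by simp [← h]⟩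

theorem vert_surjective : Function.Surjective vert := by
  rintro ⟨x, h | ⟨i, h0, h1, h2⟩⟩
  · choose u hu using fun i => abs_eq_units_mul (h i)
    obtain ⟨v, hv⟩ := coord_surj_cube (u 0) (u 1) (u 2)
    refine ⟨v, Subtype.ext (funext fun i => ?_)⟩
    change toReal (coord v i) = x i
    rw [hv, hu i]
    fin_cases i <;> simp [toReal_apply]
  · obtain ⟨a, ha⟩ := abs_eq_units_mul h1
    obtain ⟨b, hb⟩ := abs_eq_units_mul h2
    obtain ⟨v, hv0, hv1, hv2⟩ := coord_surj_other i a b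
    refine ⟨v, Subtype.ext (funext fun j => ?_)⟩
    have hj : j = i ∨ j = i + 1 ∨ j = i + 2 := by
      clear h0 h1 h2 ha hb hv0 hv1 hv2
      revert i j
      decide
    rw [vert_val]
    rcases hj with rfl | rfl | rfl
    · simp [hv0, h0]
    · simp only [hv1, ha, ← toReal_inv_phi, toReal_apply]
      push_cast
      ring
    · simp [hv2, hb, toReal_apply]

theorem anti_vert (v : Fin 20) : (vert v).anti = vert v.rev :=
  Subtype.ext (funext fun i => by
    simp only [Vertex.anti, vert_val, Pi.neg_apply, coord_rev, map_neg])

theorem dot_vert (v w : Fin 20) :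
    (vert v).1 ⬝ᵥ (vert w).1 = toReal (dotZ (coord v) (coord w)) := by
  simp only [vert_val, dotProduct, Fin.sum_univ_three, dotZ, map_add, map_mul]

theorem distSq_vert (v w : Fin 20) :
    distSq (vert v) (vert w) = toReal (dotZ (coord v - coord w) (coord v - coord w)) := by
  simp only [distSq, vert_val, dotProduct, Fin.sum_univ_three, dotZ, map_add, map_mul,
    Pi.sub_apply, map_sub]

theorem vol_vert (u v w : Fin 20) :
    vol (vert u).1 (vert v).1 (vert w).1 = toReal (volZ (coord u) (coord v) (coord w)) := by
  simp only [vol, Matrix.det_fin_three, Matrix.of_apply, Matrix.cons_val, vert_val, volZ,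
    map_add, map_mul, map_sub]

theorem isEdge_iff (v w : Fin 20) :
    distSq (vert v) (vert w) = (2 / Real.goldenRatio) ^ 2 ↔ ∃ i, w = nbr v i := by
  have h : (2 / Real.goldenRatio) ^ 2 = toReal ⟨8, -4⟩ := by
    rw [div_eq_mul_inv, ← toReal_inv_phi, toReal_apply, toReal_apply]
    push_cast
    linear_combination 4 * Real.goldenRatio_sq
  rw [← distZ_eq_iff, distSq_vert, h, toReal_injective.eq_iff]

/-- The oriented edge from the vertex number `v` to its neighbour number `i`. -/
noncomputable def dart (v : Fin 20) (i : Fin 3) : Dart :=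
  ⟨(vert v, vert (nbr v i)), (isEdge_iff _ _).2 ⟨i, rfl⟩⟩

theorem dart_ini (v : Fin 20) (i : Fin 3) : (dart v i).ini = vert v := rfl

theorem dart_ter (v : Fin 20) (i : Fin 3) : (dart v i).ter = vert (nbr v i) := rfl

theorem exists_dart (p : Dart) : ∃ v i, p = dart v i := by
  obtain ⟨⟨x, y⟩, h⟩ := p
  obtain ⟨v, rfl⟩ := vert_surjective x
  obtain ⟨w, rfl⟩ := vert_surjective y
  obtain ⟨i, rfl⟩ := (isEdge_iff v w).1 h
  exact ⟨v, i, rfl⟩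

theorem dart_injective : Function.Injective fun a : Fin 20 × Fin 3 => dart a.1 a.2 := by
  rintro ⟨v, i⟩ ⟨w, j⟩ h
  obtain rfl : v = w := vert_injective (congrArg Dart.ini h)
  obtain rfl : i = j := nbr_injective v i j (vert_injective (congrArg Dart.ter h))
  rfl

theorem Dart.ext' {p q : Dart} (h1 : p.ini = q.ini) (h2 : p.ter = q.ter) : p = q :=
  Subtype.ext (Prod.ext h1 h2)

/-- The oriented edges are numbered by a vertex and one of its three neighbours. -/
noncomputable def dartEquiv : Fin 20 × Fin 3 ≃ Dart :=
  Equiv.ofBijective (fun a => dart a.1 a.2)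
    ⟨dart_injective, fun p => (exists_dart p).elim fun v ⟨i, h⟩ => ⟨(v, i), h.symm⟩⟩

namespace Dart

/-- The next oriented edge, in counterclockwise order, with the same initial point. -/
noncomputable def rot (p : Dart) : Dart :=
  dart (dartEquiv.symm p).1 ((dartEquiv.symm p).2 + 1)

end Dart

theorem rot_dart (v : Fin 20) (i : Fin 3) : (dart v i).rot = dart v (i + 1) := by
  have : dartEquiv.symm (dart v i) = (v, i) := dartEquiv.symm_apply_apply (v, i)
  simp only [Dart.rot, this]

namespace Dart

@[simp] theorem rot_ini (p : Dart) : p.rot.ini = p.ini := by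
  obtain ⟨v, i, rfl⟩ := exists_dart p
  rw [rot_dart]
  rfl

@[simp] theorem rot_rot_rot (p : Dart) : p.rot.rot.rot = p := by
  obtain ⟨v, i, rfl⟩ := exists_dart p
  simp only [rot_dart, add_assoc]
  congr 1
  revert i
  decide

theorem rot_ne (p : Dart) : p.rot ≠ p := by
  obtain ⟨v, i, rfl⟩ := exists_dart p
  rw [rot_dart]
  intro h
  have : i + 1 = i := congrArg Prod.snd (@dart_injective (v, i + 1) (v, i) h)
  clear h
  revert i
  decide

theorem rot_rot_ne (p : Dart) : p.rot.rot ≠ p := fun h => by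
  have := rot_rot_rot p
  rw [h] at this
  exact rot_ne p this

theorem eq_or_of_ini_eq {p q : Dart} (h : q.ini = p.ini) :
    q = p ∨ q = p.rot ∨ q = p.rot.rot := by
  obtain ⟨v, i, rfl⟩ := exists_dart p
  obtain ⟨w, j, rfl⟩ := exists_dart q
  obtain rfl : w = v := vert_injective h
  rw [rot_dart, rot_dart]
  have : j = i ∨ j = i + 1 ∨ j = i + 1 + 1 := by
    clear h
    revert i j
    decide
  rcases this with rfl | rfl | rfl
  · exact Or.inl rfl
  · exact Or.inr (Or.inl rfl)
  · exact Or.inr (Or.inr rfl)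

theorem vol_rot_pos (p : Dart) : 0 < vol p.ini.1 p.ter.1 p.rot.ter.1 := by
  obtain ⟨v, i, rfl⟩ := exists_dart p
  rw [rot_dart, dart_ini, dart_ter, dart_ter, vol_vert, volZ_nbr, map_ofNat]
  exact two_pos

end Dart

theorem vol_swap (x y z : Fin 3 → ℝ) : vol x z y = -vol x y z := by
  simp only [vol, Matrix.det_fin_three, Matrix.of_apply, Matrix.cons_val]
  ring

theorem vol_rotate (x y z : Fin 3 → ℝ) : vol y z x = vol x y z := by
  simp only [vol, Matrix.det_fin_three, Matrix.of_apply, Matrix.cons_val]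
  ring

theorem vol_self (x y : Fin 3 → ℝ) : vol x y y = 0 := by
  simp only [vol, Matrix.det_fin_three, Matrix.of_apply, Matrix.cons_val]
  ring

theorem vol_neg (x y z : Fin 3 → ℝ) : vol (-x) (-y) (-z) = -vol x y z := by
  simp only [vol, Matrix.det_fin_three, Matrix.of_apply, Matrix.cons_val, Pi.neg_apply]
  ring

namespace Dart

/-- The successor in the cyclic order is characterized by the orientation. -/
theorem eq_rot_iff (p q : Dart) :
    q = p.rot ↔ q.ini = p.ini ∧ 0 < vol p.ini.1 p.ter.1 q.ter.1 := by
  constructor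
  · rintro rfl
    exact ⟨rot_ini p, vol_rot_pos p⟩
  · rintro ⟨h, hv⟩
    rcases eq_or_of_ini_eq h with rfl | rfl | rfl
    · rw [vol_self] at hv
      exact absurd hv (lt_irrefl _)
    · rfl
    · have := vol_rot_pos p.rot.rot
      rw [rot_rot_rot, rot_ini, rot_ini, vol_swap] at this
      linarith

theorem smul_rot (g : Icos) (p : Dart) : g • p.rot = (g • p).rot := by
  rw [eq_rot_iff]
  refine ⟨congrArg (g • ·) (rot_ini p), ?_⟩
  have := vol_rot_pos p
  rwa [← g.vol_smul] at this

theorem rot_anti_rot (p : Dart) : p.rot.anti.rot = p.anti := by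
  symm
  rw [eq_rot_iff]
  refine ⟨congrArg Vertex.anti (rot_ini p).symm, ?_⟩
  change 0 < vol (-p.rot.ini.1) (-p.rot.ter.1) (-p.ter.1)
  rw [vol_neg, vol_swap, neg_neg, rot_ini]
  exact vol_rot_pos p

theorem anti_rot (p : Dart) : p.rot.anti = p.anti.rot.rot := by
  rw [← rot_anti_rot p, rot_rot_rot]

/-- On the counterclockwise boundary of a face, the next oriented edge is the clockwise neighbour of
the reversed oriented edge. -/
theorem follows_iff (p q : Dart) : Follows p q ↔ q = p.rev.rot.rot := by
  have h1 : q = p.rev.rot.rot ↔ p.rev = q.rot :=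
    ⟨fun h => by rw [h, rot_rot_rot], fun h => by rw [h, rot_rot_rot]⟩
  rw [h1, eq_rot_iff]
  constructor
  · rintro ⟨h, hv⟩
    refine ⟨h.symm, ?_⟩
    rw [h, vol_rotate]
    exact hv
  · rintro ⟨h, hv⟩
    refine ⟨h.symm, ?_⟩
    rw [← vol_rotate, ← vol_rotate, vol_rotate]
    change p.ter = q.ini at h
    rw [h]
    exact hv

end Dart

theorem nbr_exists_lt : ∀ v : Fin 20, v ≠ 0 → ∃ i, nbr v i < v := by decide +kernel

/-- The graph of edges is connected. -/
theorem Dart.eq_of_rot_rev {α : Type*} (f : Dart → α) (hrot : ∀ p, f p.rot = f p)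
    (hrev : ∀ p : Dart, f p.rev = f p) (p q : Dart) : f p = f q := by
  have hini : ∀ p q : Dart, p.ini = q.ini → f p = f q := fun p q h => by
    rcases Dart.eq_or_of_ini_eq h with rfl | rfl | rfl <;> simp [hrot]
  have key : ∀ v : Fin 20, ∀ i, f (dart v i) = f (dart 0 0) := by
    intro v
    induction v using WellFoundedLT.induction with
    | ind v ih =>
      intro i
      by_cases hv : v = 0
      · subst hv
        exact hini _ _ rfl
      · obtain ⟨j, hj⟩ := nbr_exists_lt v hv
        rw [hini (dart v i) (dart v j) rfl, ← hrev, ← ih _ hj 0]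
        exact hini _ _ rfl
  obtain ⟨v, i, rfl⟩ := exists_dart p
  obtain ⟨w, j, rfl⟩ := exists_dart q
  rw [key v, key w]

/-! ### Three rotations and the inscribed cubes -/

theorem vert_eq_mulVec_of (A : Fin 3 → Fin 3 → GoldenInt) (σ : Fin 20 → Fin 20)
    (hσ : ∀ v i, dotZ (A i) (coord v) = 2 * coord (σ v) i) (v : Fin 20) :
    (Matrix.of fun i j => toReal (A i j) / 2) *ᵥ (vert v).1 = (vert (σ v)).1 := by
  funext i
  have := congrArg toReal (hσ v i)
  simp only [dotZ, map_add, map_mul, map_ofNat] at this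
  simp only [Matrix.mulVec, dotProduct, Fin.sum_univ_three, vert_val, Matrix.of_apply]
  linarith

/-- The rotation with matrix `A / 2`, where `A` has entries in `ℤ[φ]`, and which permutes the
vertices by `σ`. -/
noncomputable def rotation (A : Fin 3 → Fin 3 → GoldenInt) (σ : Fin 20 → Fin 20)
    (hA : ∀ i j, dotZ (fun k => A k i) (fun k => A k j) = if i = j then 4 else 0)
    (hdet : volZ (A 0) (A 1) (A 2) = 8)
    (hσ : ∀ v i, dotZ (A i) (coord v) = 2 * coord (σ v) i)
    (hsurj : ∀ v, ∃ w, σ w = v) : Icos :=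
  have horth : (Matrix.of fun i j => toReal (A i j) / 2)ᵀ *
      (Matrix.of fun i j => toReal (A i j) / 2) = 1 := by
    ext i j
    have := congrArg toReal (hA i j)
    simp only [dotZ, map_add, map_mul] at this
    simp only [Matrix.mul_apply, Matrix.transpose_apply, Matrix.of_apply, Fin.sum_univ_three,
      Matrix.one_apply]
    split_ifs at this ⊢ <;> simp only [map_ofNat, map_zero] at this <;> linarith
  ⟨⟨Matrix.of fun i j => toReal (A i j) / 2, by
    rw [Matrix.mem_specialOrthogonalGroup_iff, Matrix.mem_orthogonalGroup_iff']
    refine ⟨by simpa [Matrix.star_eq_conjTranspose] using horth, ?_⟩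
    have := congrArg toReal hdet
    simp only [volZ, map_add, map_sub, map_mul, map_ofNat] at this
    simp only [Matrix.det_fin_three, Matrix.of_apply]
    linarith⟩, by
    intro x
    change IsVertex ((Matrix.of fun i j => toReal (A i j) / 2) *ᵥ x) ↔ _
    constructor
    · intro h
      obtain ⟨v, hv⟩ := vert_surjective ⟨_, h⟩
      obtain ⟨w, rfl⟩ := hsurj v
      have h1 := (vert_eq_mulVec_of A σ hσ w).trans (congrArg Subtype.val hv)
      have h2 := congrArg ((Matrix.of fun i j => toReal (A i j) / 2)ᵀ *ᵥ ·) h1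
      simp only [Matrix.mulVec_mulVec, horth, Matrix.one_mulVec] at h2
      rw [← h2]
      exact (vert w).2
    · intro h
      obtain ⟨v, hv⟩ := vert_surjective ⟨x, h⟩
      obtain rfl : (vert v).1 = x := congrArg Subtype.val hv
      rw [vert_eq_mulVec_of A σ hσ]
      exact (vert _).2⟩

theorem rotation_smul_vert (A : Fin 3 → Fin 3 → GoldenInt) (σ : Fin 20 → Fin 20) (hA hdet hσ hsurj)
    (v : Fin 20) : rotation A σ hA hdet hσ hsurj • vert v = vert (σ v) :=
  Subtype.ext (vert_eq_mulVec_of A σ hσ v)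

/-- The permutation of the vertices by `rotThree`. -/
def permThree : Fin 20 → Fin 20 :=
  ![0, 2, 3, 1, 6, 7, 8, 9, 4, 5, 14, 15, 10, 11, 12, 13, 18, 16, 17, 19]

/-- The permutation of the vertices by `rotTwo`. -/
def permTwo : Fin 20 → Fin 20 :=
  ![15, 18, 12, 9, 19, 14, 8, 17, 6, 3, 16, 13, 2, 11, 5, 0, 10, 7, 1, 4]

/-- The permutation of the vertices by `rotFive`. -/
def permFive : Fin 20 → Fin 20 :=
  ![1, 4, 0, 5, 7, 10, 3, 2, 13, 8, 11, 6, 17, 16, 9, 12, 14, 19, 15, 18]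

/-- The rotation `(x, y, z) ↦ (y, z, x)` of order three. -/
noncomputable def rotThree : Icos :=
  rotation ![![0, 2, 0], ![0, 0, 2], ![2, 0, 0]] permThree (by decide +kernel)
    (by decide +kernel) (by decide +kernel) (by decide +kernel)

/-- The rotation `(x, y, z) ↦ (x, -y, -z)` of order two. -/
noncomputable def rotTwo : Icos :=
  rotation ![![2, 0, 0], ![0, -2, 0], ![0, 0, -2]] permTwo (by decide +kernel)
    (by decide +kernel) (by decide +kernel) (by decide +kernel)

/-- A rotation of order five; it permutes the inscribed cubes cyclically. -/
noncomputable def rotFive : Icos :=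
  rotation ![![⟨-1, 1⟩, 1, ⟨0, -1⟩], ![-1, ⟨0, 1⟩, ⟨-1, 1⟩], ![⟨0, 1⟩, ⟨-1, 1⟩, 1]] permFive
    (by decide +kernel) (by decide +kernel) (by decide +kernel) (by decide +kernel)

theorem rotThree_smul (v : Fin 20) : rotThree • vert v = vert (permThree v) :=
  rotation_smul_vert ..

theorem rotTwo_smul (v : Fin 20) : rotTwo • vert v = vert (permTwo v) :=
  rotation_smul_vert ..

theorem rotFive_smul (v : Fin 20) : rotFive • vert v = vert (permFive v) :=
  rotation_smul_vert ..

/-- The numbers of the vertices `(±1, ±1, ±1)`. -/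
def baseVerts : Finset (Fin 20) := {0, 4, 6, 8, 11, 13, 15, 19}

theorem mem_baseVerts : ∀ v, v ∈ baseVerts ↔ ∀ i, coord v i = 1 ∨ coord v i = -1 := by
  decide +kernel

/-- The inscribed cube with vertices `(±1, ±1, ±1)`. -/
def baseCube : Cube :=
  ⟨{x | ∀ i, |x.1 i| = 1}, ![1, 0, 0], ![0, 1, 0], ![0, 0, 1], by simp, by simp, by simp,
    by simp, by simp, by
    ext y
    constructor
    · rintro ⟨x, hx, rfl⟩
      choose u hu using fun i => abs_eq_units_mul (hx i)
      refine ⟨u 0, u 1, u 2, funext fun i => ?_⟩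
      rw [hu i]
      fin_cases i <;> simp [Units.smul_def]
    · rintro ⟨i, j, k, rfl⟩
      have h : ∀ l, |(i • ![1, 0, 0] + j • ![0, 1, 0] + k • ![0, 0, 1] : Fin 3 → ℝ) l| = 1 := by
        intro l
        rcases Int.units_eq_one_or i with rfl | rfl <;>
          rcases Int.units_eq_one_or j with rfl | rfl <;>
          rcases Int.units_eq_one_or k with rfl | rfl <;>
          fin_cases l <;> simp [Units.smul_def]
      exact ⟨⟨_, Or.inl h⟩, h, rfl⟩⟩

theorem vert_mem_baseCube (v : Fin 20) : vert v ∈ baseCube.1 ↔ v ∈ baseVerts := by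
  rw [mem_baseVerts]
  refine forall_congr' fun i => ?_
  change |toReal (coord v i)| = 1 ↔ _
  rw [abs_eq zero_le_one, ← toReal_injective.eq_iff, ← toReal_injective.eq_iff, map_neg, map_one]

theorem cube_ext {e f : Cube} (h : ∀ v, vert v ∈ e.1 ↔ vert v ∈ f.1) : e = f := by
  refine Subtype.ext (Set.ext fun x => ?_)
  obtain ⟨v, rfl⟩ := vert_surjective x
  exact h v

theorem smul_mem_smul_cube (g : Icos) (x : Vertex) (e : Cube) : g • x ∈ (g • e).1 ↔ x ∈ e.1 :=
  (MulAction.injective g).mem_set_image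

theorem rotThree_baseCube : rotThree • baseCube = baseCube := by
  refine cube_ext fun v => ?_
  have : ∀ v, ∃ w, permThree w = v ∧ (w ∈ baseVerts ↔ v ∈ baseVerts) := by decide +kernel
  obtain ⟨w, rfl, hw⟩ := this v
  rw [← rotThree_smul, smul_mem_smul_cube, rotThree_smul, vert_mem_baseCube, vert_mem_baseCube, hw]

theorem rotTwo_baseCube : rotTwo • baseCube = baseCube := by
  refine cube_ext fun v => ?_
  have : ∀ v, ∃ w, permTwo w = v ∧ (w ∈ baseVerts ↔ v ∈ baseVerts) := by decide +kernel
  obtain ⟨w, rfl, hw⟩ := this v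
  rw [← rotTwo_smul, smul_mem_smul_cube, rotTwo_smul, vert_mem_baseCube, vert_mem_baseCube, hw]

theorem vert_mem_rotFive_pow (k : ℕ) (v : Fin 20) :
    vert v ∈ (rotFive ^ k • baseCube).1 ↔ v ∈ (Finset.image permFive)^[k] baseVerts := by
  induction k generalizing v with
  | zero => simpa using vert_mem_baseCube v
  | succ k ih =>
    have : ∀ v, ∃ w, permFive w = v := by decide +kernel
    obtain ⟨w, rfl⟩ := this v
    have hinj : Function.Injective permFive :=
      Finite.injective_iff_surjective.2 this
    rw [pow_succ', mul_smul, ← rotFive_smul, smul_mem_smul_cube, ih, Function.iterate_succ_apply',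
      Finset.mem_image]
    exact ⟨fun h => ⟨w, h, rfl⟩, fun ⟨w', h, hw⟩ => hinj hw ▸ h⟩

/-- Four vertices with pairwise scalar products `-1` form one half of one of the five cubes. -/
theorem exists_cube_of_tetrahedron : ∀ a b, dotZ (coord a) (coord b) = -1 →
    ∀ c, dotZ (coord a) (coord c) = -1 → dotZ (coord b) (coord c) = -1 →
    ∀ d, dotZ (coord a) (coord d) = -1 → dotZ (coord b) (coord d) = -1 →
      dotZ (coord c) (coord d) = -1 →
    ∃ k : Fin 5, ∀ v, v ∈ (Finset.image permFive)^[k] baseVerts ↔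
      v ∈ [a, b, c, d, a.rev, b.rev, c.rev, d.rev] := by
  decide +kernel

theorem dotZ_self : ∀ v, dotZ (coord v) (coord v) = 3 := by decide +kernel

/-- Every inscribed cube is one of the five images of the standard one. -/
theorem exists_eq_rotFive_pow_smul (e : Cube) : ∃ k : ℕ, e = rotFive ^ k • baseCube := by
  obtain ⟨S, a, b, c, hab, hbc, hac, h1, h2, hS⟩ := e
  have hmem : ∀ i j k : ℤˣ, ∃ v, (vert v).1 = i • a + j • b + k • c ∧ vert v ∈ S := by
    intro i j k
    have : i • a + j • b + k • c ∈ Subtype.val '' S := hS ▸ ⟨i, j, k, rfl⟩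
    obtain ⟨x, hx, hx'⟩ := this
    obtain ⟨v, rfl⟩ := vert_surjective x
    exact ⟨v, hx', hx⟩
  have hba : b ⬝ᵥ a = 0 := by rwa [dotProduct_comm]
  have hcb : c ⬝ᵥ b = 0 := by rwa [dotProduct_comm]
  have hca : c ⬝ᵥ a = 0 := by rwa [dotProduct_comm]
  obtain ⟨p, hp, hpS⟩ := hmem 1 1 1
  obtain ⟨q, hq, hqS⟩ := hmem 1 (-1) (-1)
  obtain ⟨r, hr, hrS⟩ := hmem (-1) 1 (-1)
  obtain ⟨s, hs, hsS⟩ := hmem (-1) (-1) 1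
  simp only [Units.smul_def, Units.val_one, Units.val_neg, one_smul, neg_smul] at hp hq hr hs
  have hnorm : a ⬝ᵥ a = 1 ∧ b ⬝ᵥ b = 1 ∧ c ⬝ᵥ c = 1 := by
    have h3 := dot_vert p p
    rw [dotZ_self, map_ofNat, hp] at h3
    simp only [add_dotProduct, dotProduct_add, hab, hbc, hac, hba, hcb, hca] at h3
    refine ⟨?_, ?_, ?_⟩ <;> linarith
  obtain ⟨ha, hb, hc⟩ := hnorm
  have hdot : ∀ u v, (vert u).1 ⬝ᵥ (vert v).1 = -1 → dotZ (coord u) (coord v) = -1 := by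
    intro u v h
    apply toReal_injective
    rw [← dot_vert, h, map_neg, map_one]
  obtain ⟨hpq, hpr, hqr, hps, hqs, hrs⟩ : (vert p).1 ⬝ᵥ (vert q).1 = -1 ∧
      (vert p).1 ⬝ᵥ (vert r).1 = -1 ∧ (vert q).1 ⬝ᵥ (vert r).1 = -1 ∧
      (vert p).1 ⬝ᵥ (vert s).1 = -1 ∧ (vert q).1 ⬝ᵥ (vert s).1 = -1 ∧
      (vert r).1 ⬝ᵥ (vert s).1 = -1 := by
    simp only [hp, hq, hr, hs, add_dotProduct, dotProduct_add, neg_dotProduct, dotProduct_neg,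
      hab, hbc, hac, hba, hcb, hca, ha, hb, hc]
    norm_num
  obtain ⟨k, hk⟩ := exists_cube_of_tetrahedron p q (hdot _ _ hpq) r (hdot _ _ hpr) (hdot _ _ hqr)
    s (hdot _ _ hps) (hdot _ _ hqs) (hdot _ _ hrs)
  refine ⟨k, cube_ext fun v => ?_⟩
  rw [vert_mem_rotFive_pow, hk]
  have hval : vert v ∈ S ↔ (vert v).1 ∈ Subtype.val '' S :=
    (Subtype.val_injective.mem_set_image).symm
  have heq : ∀ u, v = u ↔ (vert v).1 = (vert u).1 := fun u =>
    ⟨fun h => h ▸ rfl, fun h => vert_injective (Subtype.ext h)⟩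
  have hrev : ∀ u, (vert (Fin.rev u)).1 = -(vert u).1 := fun u => by
    rw [← anti_vert]
    rfl
  simp only [List.mem_cons, List.not_mem_nil, or_false, heq, hrev, hp, hq, hr, hs]
  rw [hval, hS]
  constructor
  · rintro ⟨i, j, k, h⟩
    rw [h]
    rcases Int.units_eq_one_or i with rfl | rfl <;>
      rcases Int.units_eq_one_or j with rfl | rfl <;>
      rcases Int.units_eq_one_or k with rfl | rfl <;>
      simp only [Units.smul_def, Units.val_one, Units.val_neg, one_smul, neg_smul, neg_add,
        neg_neg, true_or, or_true]
  · have hone : ∀ x : Fin 3 → ℝ, (1 : ℤˣ) • x = x ∧ (-1 : ℤˣ) • x = -x := fun x => by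
      simp [Units.smul_def]
    rintro (h | h | h | h | h | h | h | h) <;> rw [h]
    · exact ⟨1, 1, 1, by simp only [hone]⟩
    · exact ⟨1, -1, -1, by simp only [hone]⟩
    · exact ⟨-1, 1, -1, by simp only [hone]⟩
    · exact ⟨-1, -1, 1, by simp only [hone]⟩
    · exact ⟨-1, -1, -1, by simp only [hone, neg_add]⟩
    · exact ⟨-1, 1, 1, by simp only [hone, neg_add, neg_neg]⟩
    · exact ⟨1, -1, 1, by simp only [hone, neg_add, neg_neg]⟩
    · exact ⟨1, 1, -1, by simp only [hone, neg_add, neg_neg]⟩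

theorem exists_smul_baseCube (e : Cube) : ∃ g : Icos, e = g • baseCube :=
  (exists_eq_rotFive_pow_smul e).imp' (rotFive ^ ·) fun _ h => h

/-! ### Coefficients of chains -/

theorem val_of_smul {X : Type} [MulAction Icos X] (g : Icos) (c : Fn X) (x : X) :
    (MonoidAlgebra.of ℤ Icos g • c).val x = c.val (g⁻¹ • x) := by
  rw [of_smul]
  rfl

/-- The counterclockwise side, starting at the corner `p`, of the triangle at `p.ini`. -/
noncomputable def side (p : Dart) : Side := ⟨(p, p.rot), p.rot_ini.symm, p.rot_ne.symm⟩

theorem side_injective : Function.Injective side := fun _ _ h =>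
  congrArg (fun s : Side => s.1.1) h

theorem eq_side_or (s : Side) : s = side s.1.1 ∨ s = (side s.1.2).rev := by
  obtain ⟨⟨p, q⟩, h, hne⟩ := s
  rcases Dart.eq_or_of_ini_eq h.symm with hq | hq | hq
  · exact absurd hq.symm hne
  · exact Or.inl (Subtype.ext (Prod.ext rfl hq))
  · refine Or.inr (Subtype.ext (Prod.ext ?_ rfl))
    change p = Dart.rot q
    change q = _ at hq
    rw [hq, Dart.rot_rot_rot]

theorem side_ne_rev (p q : Dart) : side p ≠ (side q).rev := fun h => by
  have h1 : p = q.rot := congrArg (fun s : Side => s.1.1) h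
  have h2 : p.rot = q := congrArg (fun s : Side => s.1.2) h
  rw [h1] at h2
  exact Dart.rot_rot_ne q h2

/-- The antipodal map reverses the orientation of the triangles. -/
theorem side_anti (p : Dart) : (side p).anti = (side p.anti.rot.rot).rev := by
  refine Subtype.ext (Prod.ext ?_ (Dart.anti_rot p))
  exact (Dart.rot_rot_rot _).symm

theorem smul_side (g : Icos) (p : Dart) : g • side p = side (g • p) :=
  Subtype.ext (Prod.ext rfl (Dart.smul_rot g p))

/-- The coefficient of a 1-chain at an oriented cell of edge type. -/
noncomputable def edge (z : C1) (p : Dart) : ℤ := z.1.1.val p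

/-- The coefficient of a 1-chain at the counterclockwise cell of truncation type that starts
at the corner `p`. -/
noncomputable def trc (z : C1) (p : Dart) : ℤ := z.2.1.val (side p)

theorem edge_rev (z : C1) (p : Dart) : edge z p.rev = -edge z p := z.1.2 p

theorem trc_rev (z : C1) (p : Dart) : z.2.1.val (side p).rev = -trc z p := z.2.2.1 (side p)

theorem trc_anti (z : C1) (p : Dart) : trc z p.anti.rot.rot = -trc z p := by
  have h := z.2.2.2 (side p)
  rw [side_anti] at h
  have h2 := trc_rev z p.anti.rot.rot
  have h3 : z.2.1.val (side p).anti.rev.rev = trc z p := by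
    rw [Side.rev_rev, side_anti]
    exact h
  rw [side_anti, Side.rev_rev] at h3
  linarith

theorem C1_ext {z z' : C1} (h1 : ∀ p, edge z p = edge z' p) (h2 : ∀ p, trc z p = trc z' p) :
    z = z' := by
  refine Prod.ext (Subtype.ext (funext h1)) (Subtype.ext (funext fun s => ?_))
  rcases eq_side_or s with h | h <;> rw [h]
  · exact h2 _
  · exact (trc_rev z _).trans ((congrArg Neg.neg (h2 _)).trans (trc_rev z' _).symm)

/-- The coefficients of edge type, as a homomorphism. -/
noncomputable def edgeHom (p : Dart) : C1 →+ ℤ where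
  toFun z := edge z p
  map_zero' := rfl
  map_add' _ _ := rfl

/-- The coefficients of truncation type, as a homomorphism. -/
noncomputable def trcHom (p : Dart) : C1 →+ ℤ where
  toFun z := trc z p
  map_zero' := rfl
  map_add' _ _ := rfl

theorem edge_zsmul (n : ℤ) (z : C1) (p : Dart) : edge (n • z) p = n * edge z p :=
  (map_zsmul (edgeHom p) n z).trans (smul_eq_mul _ _)

theorem trc_zsmul (n : ℤ) (z : C1) (p : Dart) : trc (n • z) p = n * trc z p :=
  (map_zsmul (trcHom p) n z).trans (smul_eq_mul _ _)

theorem edge_add (z z' : C1) (p : Dart) : edge (z + z') p = edge z p + edge z' p := rfl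

theorem trc_add (z z' : C1) (p : Dart) : trc (z + z') p = trc z p + trc z' p := rfl

theorem edge_smul (g : Icos) (z : C1) (p : Dart) :
    edge (MonoidAlgebra.of ℤ Icos g • z) p = edge z (g⁻¹ • p) :=
  val_of_smul g z.1.1 p

theorem trc_smul (g : Icos) (z : C1) (p : Dart) :
    trc (MonoidAlgebra.of ℤ Icos g • z) p = trc z (g⁻¹ • p) := by
  have := val_of_smul g z.2.1 (side p)
  rw [smul_side] at this
  exact this

/-- The coefficients of truncation type determine a function on all sides. -/
theorem exists_CTrc (t : Dart → ℤ) (ht : ∀ p, t p.anti.rot.rot = -t p) :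
    ∃ c : CTrc, ∀ p, c.1.val (side p) = t p := by
  classical
  let c : Side → ℤ := fun s => if s = side s.1.1 then t s.1.1 else -t s.1.2
  have h1 : ∀ p, c (side p) = t p := fun p => if_pos rfl
  have h2 : ∀ p, c (side p).rev = -t p := fun p => if_neg (side_ne_rev _ _).symm
  refine ⟨⟨Fn.mk c, ⟨fun s => ?_, fun s => ?_⟩⟩, h1⟩
  · change c s.rev = -c s
    rcases eq_side_or s with h | h <;> rw [h]
    · rw [h1, h2]
    · rw [Side.rev_rev, h1, h2, neg_neg]
  · change c s.anti = c s
    rcases eq_side_or s with h | h <;> rw [h]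
    · rw [side_anti, h1, h2, ht, neg_neg]
    · rw [Side.anti_rev, side_anti, Side.rev_rev, h1, h2, ht]

/-- The 1-chain with given coefficients. -/
theorem exists_C1 (f t : Dart → ℤ) (hf : ∀ p : Dart, f p.rev = -f p)
    (ht : ∀ p, t p.anti.rot.rot = -t p) :
    ∃ z : C1, (∀ p, edge z p = f p) ∧ ∀ p, trc z p = t p := by
  obtain ⟨c, hc⟩ := exists_CTrc t ht
  exact ⟨(⟨Fn.mk f, hf⟩, c), fun _ => rfl, hc⟩

/-- A sum over the sides that end at the corner `p` has two terms. -/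
theorem sum_side_end (c : Side → ℤ) (p : Dart) :
    (∑ s : Side, if s.1.2 = p then c s else 0) = c (side p.rot.rot) + c (side p).rev := by
  classical
  rw [← Finset.sum_filter]
  have : (Finset.univ.filter fun s : Side => s.1.2 = p) = {side p.rot.rot, (side p).rev} := by
    ext s
    simp only [Finset.mem_filter, Finset.mem_univ, true_and, Finset.mem_insert,
      Finset.mem_singleton]
    constructor
    · intro h
      rcases eq_side_or s with hs | hs
      · left
        have : s.1.1.rot = p := (congrArg (fun s : Side => s.1.2) hs).symm.trans h
        rw [← this, Dart.rot_rot_rot]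
        exact hs
      · right
        rw [← h]
        exact hs
    · rintro (rfl | rfl)
      · exact Dart.rot_rot_rot p
      · rfl
  rw [this, Finset.sum_pair (side_ne_rev _ _)]

theorem mem_Z1_iff (z : C1) : z ∈ Z1 ↔ ∀ p : Dart,
    edge z p.rev + edge z p.anti.rev + (trc z p.rot.rot - trc z p) = 0 := by
  classical
  have h : ∀ p : Dart, (boundary1 z).1.val p =
      edge z p.rev + edge z p.anti.rev + (trc z p.rot.rot - trc z p) := fun p => by
    change edge z p.rev + edge z p.anti.rev +
      (∑ s : Side, if s.1.2 = p then z.2.1.val s else 0) = _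
    rw [sum_side_end, trc_rev]
    rfl
  rw [LinearMap.mem_ker]
  constructor
  · intro hz p
    rw [← h, hz]
    rfl
  · exact fun hz => Subtype.ext (funext fun p => (h p).trans (hz p))

/-- The value of a 2-chain on the face on the left of an oriented edge. -/
noncomputable def faceVal (c : C2) (p : Dart) : ℤ := c.1.val p

theorem faceVal_rot_rot_rev (c : C2) (p : Dart) : faceVal c p.rev.rot.rot = faceVal c p :=
  (c.2 p _ ((Dart.follows_iff _ _).2 rfl)).symm

theorem faceVal_rot_rot (c : C2) (p : Dart) : faceVal c p.rot.rot = faceVal c p.rev := by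
  conv_rhs => rw [← faceVal_rot_rot_rev, Dart.rev_rev]

theorem exists_C2 (f : Dart → ℤ) (hf : ∀ p : Dart, f p.rev.rot.rot = f p) :
    ∃ c : C2, ∀ p, faceVal c p = f p :=
  ⟨⟨Fn.mk f, fun p q h => by
    rw [Dart.follows_iff] at h
    rw [h]
    exact (hf p).symm⟩, fun _ => rfl⟩

theorem edge_boundary2 (c : C2) (p : Dart) :
    edge (boundary2 c) p = faceVal c p - faceVal c p.rev := rfl

theorem faceCoeff_side (c : C2) (p : Dart) : faceCoeff c.1.val (side p) = -faceVal c p := by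
  have h1 : ¬ Dart.Follows (side p).1.1.rev (side p).1.2 := by
    rw [Dart.follows_iff, Dart.rev_rev]
    exact fun h => Dart.rot_ne p.rot h.symm
  have h2 : Dart.Follows (side p).1.2.rev (side p).1.1 := by
    rw [Dart.follows_iff, Dart.rev_rev]
    exact (Dart.rot_rot_rot p).symm
  rw [faceCoeff, if_neg h1, if_pos h2, zero_sub]
  rfl

theorem trc_boundary2 (c : C2) (p : Dart) :
    trc (boundary2 c) p = faceVal c p.anti.rev - faceVal c p := by
  change faceCoeff c.1.val (side p) + faceCoeff c.1.val (side p).anti = _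
  rw [side_anti, faceCoeff_rev, faceCoeff_side, faceCoeff_side, faceVal_rot_rot]
  ring

/-- `∂₁ ∂₂ = 0`. -/
theorem boundary2_mem_Z1 (c : C2) : boundary2 c ∈ Z1 := by
  rw [mem_Z1_iff]
  intro p
  have h : p.rot.rot.anti.rev = p.anti.rot.rev := by
    rw [Dart.anti_rot, Dart.anti_rot, Dart.rot_rot_rot]
  have h2 : faceVal c p.anti.rot.rev = faceVal c p.anti := by
    rw [← faceVal_rot_rot, Dart.rot_rot_rot]
  simp only [edge_boundary2, trc_boundary2, faceVal_rot_rot, Dart.rev_rev, h, h2]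
  ring

/-! ### The two families of cycles -/

/-- The function on vertices that is `1` on `E` and `-1` on its antipode, for disjoint `E`
and `ι E`. -/
noncomputable def signOf (E : Set Vertex) (x : Vertex) : ℤ :=
  E.indicator (fun _ => 1) x - E.indicator (fun _ => 1) x.anti

theorem signOf_anti (E : Set Vertex) (x : Vertex) : signOf E x.anti = -signOf E x := by
  simp only [signOf, Vertex.anti_anti]
  ring

theorem signOf_image_anti (E : Set Vertex) (x : Vertex) :
    signOf (Vertex.anti '' E) x = -signOf E x := by
  have h : ∀ y : Vertex, y ∈ Vertex.anti '' E ↔ y.anti ∈ E := fun y =>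
    ⟨by rintro ⟨z, hz, rfl⟩; rwa [Vertex.anti_anti], fun hy => ⟨_, hy, Vertex.anti_anti y⟩⟩
  classical
  simp only [signOf, Set.indicator_apply, h, Vertex.anti_anti]
  ring

theorem signOf_image_smul (g : Icos) (E : Set Vertex) (x : Vertex) :
    signOf ((g • ·) '' E) x = signOf E (g⁻¹ • x) := by
  have h : ∀ y : Vertex, y ∈ (g • ·) '' E ↔ g⁻¹ • y ∈ E := fun y =>
    Set.mem_smul_set_iff_inv_smul_mem
  classical
  simp only [signOf, Set.indicator_apply, h, smul_anti]

theorem sum_sum_ini {M : Type*} [AddCommMonoid M] (E : Set Vertex) [DecidablePred (· ∈ E)]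
    (F : Dart → M) :
    ∑ x : Vertex with x ∈ E, ∑ q : Dart with q.ini = x, F q =
      ∑ q : Dart, if q.ini ∈ E then F q else 0 := by
  rw [Finset.sum_comm' (t' := Finset.univ)
    (s' := fun q => Finset.univ.filter fun x => x ∈ E ∧ q.ini = x) (by simp)]
  refine Finset.sum_congr rfl fun q _ => ?_
  split_ifs with h
  · refine (Finset.sum_congr ?_ fun _ _ => rfl).trans (Finset.sum_singleton _ q.ini)
    ext x
    simp only [Finset.mem_filter, Finset.mem_univ, true_and, Finset.mem_singleton]
    exact ⟨fun hx => hx.2.symm, fun hx => ⟨hx ▸ h, hx.symm⟩⟩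
  · refine (Finset.sum_congr (Finset.filter_eq_empty_iff.2 ?_) fun _ _ => rfl).trans
      Finset.sum_empty
    rintro x - ⟨hx, rfl⟩
    exact h hx

theorem sum_ite_single (E : Set Vertex) [DecidablePred (· ∈ E)]
    (σ : Dart → Dart) (τ : Dart → Dart) (h1 : ∀ q, τ (σ q) = q) (h2 : ∀ q, σ (τ q) = q)
    (p : Dart) :
    (∑ q : Dart, if q.ini ∈ E then (if p = σ q then (1 : ℤ) else 0) else 0) =
      E.indicator (fun _ => 1) (τ p).ini := by
  have : ∀ q, p = σ q ↔ q = τ p := fun q => ⟨fun h => h ▸ (h1 q).symm, fun h => h ▸ (h2 p).symm⟩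
  simp only [this, ← ite_and, and_comm (a := _ ∈ E)]
  simp only [ite_and, Finset.sum_ite_eq', Finset.mem_univ, if_true, Set.indicator_apply]

theorem loopTrc_eq (x : Vertex) :
    loopTrc x = ∑ q : Dart with q.ini = x, sideCell (side q) := by
  classical
  have : (Finset.univ.filter fun s : Side => s.1.1.ini = x ∧ 0 < vol x.1 s.1.1.ter.1 s.1.2.ter.1) =
      (Finset.univ.filter fun q : Dart => q.ini = x).image side := by
    ext s
    simp only [Finset.mem_filter, Finset.mem_univ, true_and, Finset.mem_image]
    constructor
    · rintro ⟨rfl, h⟩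
      refine ⟨s.1.1, rfl, Subtype.ext (Prod.ext rfl ?_)⟩
      exact ((Dart.eq_rot_iff _ _).2 ⟨s.2.1.symm, h⟩).symm
    · rintro ⟨q, rfl, rfl⟩
      exact ⟨rfl, Dart.vol_rot_pos q⟩
  rw [← Finset.sum_image (f := sideCell) (g := side) side_injective.injOn, ← this, loopTrc]

theorem sideCell_side (p q : Dart) : (sideCell (side q)).1.val (side p) =
    (if p = q then 1 else 0) - if p = q.anti.rot.rot then 1 else 0 := by
  classical
  change (Pi.single (side q) 1 + Pi.single (side q).anti 1 - Pi.single (side q).rev 1 -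
    Pi.single (side q).anti.rev 1 : Side → ℤ) (side p) = _
  simp only [side_anti, Side.rev_rev, Pi.sub_apply, Pi.add_apply, Pi.single_apply, side_ne_rev,
    side_injective.eq_iff, if_false]
  ring

theorem edgeCell_val (p q : Dart) : (edgeCell q).1.val p =
    (if p = q then 1 else 0) - if p = q.rev then 1 else 0 := by
  classical
  change (Pi.single q 1 - Pi.single q.rev 1 : Dart → ℤ) p = _
  simp only [Pi.sub_apply, Pi.single_apply]

/-- The coefficient at a side, as a homomorphism. -/
noncomputable def sideHom (p : Dart) : CTrc →+ ℤ where
  toFun c := c.1.val (side p)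
  map_zero' := rfl
  map_add' _ _ := rfl

/-- The coefficient at an oriented edge, as a homomorphism. -/
noncomputable def dartHom (p : Dart) : CEdge →+ ℤ where
  toFun c := c.1.val p
  map_zero' := rfl
  map_add' _ _ := rfl

theorem trc_deltaTrc (E : Set Vertex) (p : Dart) : trc (deltaTrc E) p = signOf E p.ini := by
  classical
  change sideHom p (∑ x : Vertex with x ∈ E, loopTrc x) = _
  simp only [loopTrc_eq]
  rw [sum_sum_ini, map_sum]
  have h : ∀ q : Dart, sideHom p (if q.ini ∈ E then sideCell (side q) else 0) =
      (if q.ini ∈ E then (if p = id q then (1 : ℤ) else 0) else 0) -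
        if q.ini ∈ E then (if p = q.anti.rot.rot then (1 : ℤ) else 0) else 0 := fun q => by
    split_ifs with h0
    all_goals first | rw [map_zero, sub_zero] | refine (sideCell_side p q).trans ?_
    all_goals simp_all
  rw [Finset.sum_congr rfl fun q _ => h q, Finset.sum_sub_distrib,
    sum_ite_single E id id (fun _ => rfl) (fun _ => rfl),
    sum_ite_single E (fun q => q.anti.rot.rot) (fun q => q.rot.anti)
      (fun q => by simp) (fun q => by rw [Dart.anti_rot]; simp [Dart.anti_rot])]
  have h2 : p.rot.anti.ini = p.ini.anti := congrArg Vertex.anti p.rot_ini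
  rw [h2, id, signOf]

theorem edge_deltaTrc (E : Set Vertex) (p : Dart) : edge (deltaTrc E) p = 0 := rfl

theorem trc_deltaEdge (E : Set Vertex) (p : Dart) : trc (deltaEdge E) p = 0 := rfl

theorem edge_deltaEdge (E : Set Vertex) (p : Dart) :
    edge (deltaEdge E) p = signOf E p.ini - signOf E p.ter := by
  classical
  change dartHom p (∑ x : Vertex with x ∈ E, ∑ y : Dart with y.ini = x, loopEdge y) = _
  rw [sum_sum_ini, map_sum]
  have h : ∀ q : Dart, dartHom p (if q.ini ∈ E then loopEdge q else 0) =
      (if q.ini ∈ E then (if p = id q then (1 : ℤ) else 0) else 0) -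
        (if q.ini ∈ E then (if p = q.rev then (1 : ℤ) else 0) else 0) -
        ((if q.ini ∈ E then (if p = q.anti then (1 : ℤ) else 0) else 0) -
          if q.ini ∈ E then (if p = q.anti.rev then (1 : ℤ) else 0) else 0) := fun q => by
    by_cases h0 : q.ini ∈ E
    · simp only [if_pos h0]
      exact congrArg₂ (· - ·) (edgeCell_val p q) (edgeCell_val p q.anti)
    · simp only [if_neg h0, map_zero, sub_zero]
  rw [Finset.sum_congr rfl fun q _ => h q, Finset.sum_sub_distrib, Finset.sum_sub_distrib,
    Finset.sum_sub_distrib,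
    sum_ite_single E id id (fun _ => rfl) (fun _ => rfl),
    sum_ite_single E Dart.rev Dart.rev Dart.rev_rev Dart.rev_rev,
    sum_ite_single E Dart.anti Dart.anti Dart.anti_anti Dart.anti_anti,
    sum_ite_single E (fun q => q.anti.rev) (fun q => q.rev.anti) (fun q => by simp)
      (fun q => by rw [Dart.anti_anti, Dart.rev_rev])]
  change E.indicator (fun _ => (1 : ℤ)) p.ini - E.indicator (fun _ => (1 : ℤ)) p.ter -
    (E.indicator (fun _ => (1 : ℤ)) p.ini.anti - E.indicator (fun _ => (1 : ℤ)) p.ter.anti) =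
    signOf E p.ini - signOf E p.ter
  simp only [signOf]
  ring

/-! ### The canonical half of a cube -/

/-- An invariant choice of one of the two halves of an inscribed cube: the vertices `x` of the cube
such that the second vertex after `x`, on the counterclockwise boundary of a face, belongs to the
cube as well. (On a face of `D`, the cube has one edge, and this distinguishes its endpoints.) -/
def Cube.half (e : Cube) : Set Vertex :=
  {x | x ∈ e.1 ∧ ∃ p q : Dart, p.ini = x ∧ Dart.Follows p q ∧ q.ter ∈ e.1}

theorem smul_mem_half_of_mem {e : Cube} {x : Vertex} (g : Icos) (h : x ∈ e.half) :
    g • x ∈ (g • e).half := by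
  obtain ⟨hx, p, q, rfl, hpq, hq⟩ := h
  exact ⟨(smul_mem_smul_cube g _ e).2 hx, g • p, g • q, rfl, (Dart.follows_smul g p q).2 hpq,
    (smul_mem_smul_cube g _ e).2 hq⟩

theorem half_smul (g : Icos) (e : Cube) : (g • e).half = (g • ·) '' e.half := by
  ext x
  constructor
  · intro h
    refine ⟨g⁻¹ • x, ?_, smul_inv_smul g x⟩
    have := smul_mem_half_of_mem g⁻¹ h
    rwa [inv_smul_smul] at this
  · rintro ⟨y, hy, rfl⟩
    exact smul_mem_half_of_mem g hy

theorem rev_dart {v : Fin 20} {i j : Fin 3} (h : nbr (nbr v i) j = v) :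
    (dart v i).rev = dart (nbr v i) j :=
  Dart.ext' rfl (congrArg vert h.symm)

theorem anti_dart {v : Fin 20} {i j : Fin 3} (h : nbr v.rev j = (nbr v i).rev) :
    (dart v i).anti = dart v.rev j :=
  Dart.ext' (anti_vert v) ((anti_vert _).trans (congrArg vert h.symm))

theorem exists_nbr_nbr : ∀ v i, ∃ j, nbr (nbr v i) j = v := by decide +kernel

theorem exists_nbr_rev : ∀ v i, ∃ j, nbr v.rev j = (nbr v i).rev := by decide +kernel

/-- The numbers of the vertices in the canonical half of the standard cube. -/
def halfVerts : Finset (Fin 20) := {0, 11, 13, 15}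

theorem vert_mem_half (v : Fin 20) : vert v ∈ baseCube.half ↔ v ∈ halfVerts := by
  have key : ∀ v, v ∈ halfVerts ↔ v ∈ baseVerts ∧
      ∃ i j, nbr (nbr v i) j = v ∧ nbr (nbr v i) (j + 1 + 1) ∈ baseVerts := by decide +kernel
  rw [key]
  refine and_congr (vert_mem_baseCube v) ⟨?_, ?_⟩
  · rintro ⟨p, q, hp, hpq, hq⟩
    obtain ⟨w, i, rfl⟩ := exists_dart p
    obtain rfl : w = v := vert_injective hp
    obtain ⟨j, hj⟩ := exists_nbr_nbr w i
    rw [Dart.follows_iff, rev_dart hj, rot_dart, rot_dart] at hpq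
    rw [hpq, dart_ter, vert_mem_baseCube] at hq
    exact ⟨i, j, hj, hq⟩
  · rintro ⟨i, j, hj, h⟩
    refine ⟨dart v i, dart (nbr v i) (j + 1 + 1), rfl, ?_, ?_⟩
    · rw [Dart.follows_iff, rev_dart hj, rot_dart, rot_dart]
    · rwa [dart_ter, vert_mem_baseCube]

/-- The values of `signOf baseCube.half`. -/
def sign (v : Fin 20) : ℤ := if v ∈ halfVerts then 1 else if v.rev ∈ halfVerts then -1 else 0

theorem signOf_half (v : Fin 20) : signOf baseCube.half (vert v) = sign v := by
  have key : ∀ v, sign v =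
      (if v ∈ halfVerts then 1 else 0) - if v.rev ∈ halfVerts then 1 else 0 := by decide +kernel
  classical
  rw [key]
  simp only [signOf, anti_vert, Set.indicator_apply, vert_mem_half]

theorem Cube.IsHalf.smul {e : Cube} {E : Set Vertex} (h : e.IsHalf E) (g : Icos) :
    (g • e).IsHalf ((g • ·) '' E) := by
  obtain ⟨h1, h2, h3⟩ := h
  have h4 : Vertex.anti '' ((g • ·) '' E) = (g • ·) '' (Vertex.anti '' E) := by
    simp only [Set.image_image, smul_anti]
  refine ⟨?_, ?_, ?_⟩
  · rw [h4, ← Set.image_union, h1]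
    rfl
  · rw [h4]
    exact (Set.disjoint_image_iff (MulAction.injective g)).2 h2
  · rintro _ ⟨x, hx, rfl⟩ _ ⟨y, hy, rfl⟩
    rw [distSq_smul]
    exact h3 x hx y hy

/-- The standard cube has two halves only. -/
theorem eq_half_of_isHalf {E : Set Vertex} (h : baseCube.IsHalf E) :
    E = baseCube.half ∨ E = Vertex.anti '' baseCube.half := by
  obtain ⟨h1, h2, h3⟩ := h
  have hanti : ∀ (F : Set Vertex) v, vert v ∈ Vertex.anti '' F ↔ vert v.rev ∈ F := fun F v => by
    rw [← anti_vert]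
    exact ⟨by rintro ⟨z, hz, hz'⟩; rwa [← hz', Vertex.anti_anti],
      fun hy => ⟨_, hy, Vertex.anti_anti _⟩⟩
  have hcov : ∀ v, v ∈ baseVerts ↔ vert v ∈ E ∨ vert v.rev ∈ E := fun v => by
    rw [← hanti, ← vert_mem_baseCube, ← h1]
    rfl
  have hdisj : ∀ v, vert v ∈ E → vert v.rev ∉ E := fun v hv hv' =>
    Set.disjoint_left.1 h2 hv ((hanti E v).2 hv')
  have hdist : ∀ v w, dotZ (coord v - coord w) (coord v - coord w) = 4 →
      vert v ∈ E → vert w ∉ E := fun v w hvw hv hw => by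
    refine h3 _ hv _ hw ?_
    rw [distSq_vert, hvw, map_ofNat]
  have hbase : ∀ v, v ∈ baseVerts ↔ v ∈ halfVerts ∨ v.rev ∈ halfVerts := by decide +kernel
  have hadj : ∀ w ∈ halfVerts, w ≠ 0 →
      dotZ (coord 0 - coord w.rev) (coord 0 - coord w.rev) = 4 ∧
      dotZ (coord 19 - coord w) (coord 19 - coord w) = 4 := by decide +kernel
  -- Membership of vertex `0` decides: the antipode of any other vertex of its half is joined to `0`
  -- by an edge of the cube. The vertex `19` is the antipode of `0`.
  by_cases h0 : vert 0 ∈ E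
  · left
    have hsub : ∀ w ∈ halfVerts, vert w ∈ E := fun w hw => by
      by_cases hw0 : w = 0
      · rwa [hw0]
      · exact ((hcov w).1 ((hbase w).2 (Or.inl hw))).resolve_right
          (hdist _ _ (hadj w hw hw0).1 h0)
    ext x
    obtain ⟨v, rfl⟩ := vert_surjective x
    rw [vert_mem_half]
    refine ⟨fun hv => ?_, hsub v⟩
    exact ((hbase v).1 ((hcov v).2 (Or.inl hv))).resolve_right fun hr => hdisj v hv (hsub _ hr)
  · right
    have h19 : vert 19 ∈ E := ((hcov 0).1 (by decide)).resolve_left h0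
    have hsub : ∀ w ∈ halfVerts, vert w.rev ∈ E := fun w hw => by
      by_cases hw0 : w = 0
      · rwa [hw0]
      · exact ((hcov w).1 ((hbase w).2 (Or.inl hw))).resolve_left
          (hdist _ _ (hadj w hw hw0).2 h19)
    ext x
    obtain ⟨v, rfl⟩ := vert_surjective x
    rw [hanti, vert_mem_half]
    refine ⟨fun hv => ?_, fun hv => ?_⟩
    · exact ((hbase v).1 ((hcov v).2 (Or.inl hv))).resolve_left fun hr => hdisj v hv (hsub _ hr)
    · have := hsub _ hv
      rwa [Fin.rev_rev] at this

/-! ### Invariant cycles -/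

theorem deltaTrc_mem_Z1 (E : Set Vertex) : deltaTrc E ∈ Z1 := by
  rw [mem_Z1_iff]
  intro p
  simp only [edge_deltaTrc, trc_deltaTrc, Dart.rot_ini]
  ring

theorem deltaEdge_mem_Z1 (E : Set Vertex) : deltaEdge E ∈ Z1 := by
  rw [mem_Z1_iff]
  intro p
  have h1 : signOf E p.anti.rev.ini = -signOf E p.ter := signOf_anti E p.ter
  have h2 : signOf E p.anti.rev.ter = -signOf E p.ini := signOf_anti E p.ini
  rw [edge_deltaEdge, edge_deltaEdge, trc_deltaEdge, trc_deltaEdge, h1, h2]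
  change signOf E p.ter - signOf E p.ini + _ + _ = 0
  ring

theorem deltaTrc_image_smul (g : Icos) (E : Set Vertex) :
    deltaTrc ((g • ·) '' E) = MonoidAlgebra.of ℤ Icos g • deltaTrc E := by
  refine C1_ext (fun p => ?_) fun p => ?_
  · rw [edge_smul, edge_deltaTrc, edge_deltaTrc]
  · rw [trc_smul, trc_deltaTrc, trc_deltaTrc, signOf_image_smul]
    rfl

theorem deltaEdge_image_smul (g : Icos) (E : Set Vertex) :
    deltaEdge ((g • ·) '' E) = MonoidAlgebra.of ℤ Icos g • deltaEdge E := by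
  refine C1_ext (fun p => ?_) fun p => ?_
  · rw [edge_smul, edge_deltaEdge, edge_deltaEdge, signOf_image_smul, signOf_image_smul]
    rfl
  · rw [trc_smul, trc_deltaEdge, trc_deltaEdge]

theorem deltaTrc_image_anti (E : Set Vertex) :
    deltaTrc (Vertex.anti '' E) = (-1 : ℤ) • deltaTrc E := by
  refine C1_ext (fun p => ?_) fun p => ?_
  · rw [edge_zsmul, edge_deltaTrc, edge_deltaTrc, mul_zero]
  · rw [trc_zsmul, trc_deltaTrc, trc_deltaTrc, signOf_image_anti, neg_one_mul]

theorem deltaEdge_image_anti (E : Set Vertex) :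
    deltaEdge (Vertex.anti '' E) = (-1 : ℤ) • deltaEdge E := by
  refine C1_ext (fun p => ?_) fun p => ?_
  · rw [edge_zsmul, edge_deltaEdge, edge_deltaEdge, signOf_image_anti, signOf_image_anti]
    ring
  · rw [trc_zsmul, trc_deltaEdge, trc_deltaEdge, mul_zero]

/-- The permutation of the vertices by the element `rotThree ^ k * rotTwo ^ l * rotThree ^ m` of
the stabilizer of the standard cube. -/
def wordPerm (k l m : ℕ) (v : Fin 20) : Fin 20 := permThree^[k] (permTwo^[l] (permThree^[m] v))

theorem pow_smul_vert {g : Icos} {σ : Fin 20 → Fin 20} (h : ∀ v, g • vert v = vert (σ v)) (k : ℕ)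
    (v : Fin 20) : g ^ k • vert v = vert (σ^[k] v) := by
  induction k with
  | zero => simp
  | succ k ih => rw [pow_succ', mul_smul, ih, h, Function.iterate_succ_apply']

theorem exists_stabilizer_smul (k l m : ℕ) :
    ∃ g ∈ MulAction.stabilizer Icos baseCube, ∀ v, g • vert v = vert (wordPerm k l m v) := by
  refine ⟨rotThree ^ k * rotTwo ^ l * rotThree ^ m, ?_, fun v => ?_⟩
  · have h3 : rotThree ∈ MulAction.stabilizer Icos baseCube := rotThree_baseCube
    have h2 : rotTwo ∈ MulAction.stabilizer Icos baseCube := rotTwo_baseCube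
    exact mul_mem (mul_mem (pow_mem h3 k) (pow_mem h2 l)) (pow_mem h3 m)
  · rw [mul_smul, mul_smul, pow_smul_vert rotThree_smul, pow_smul_vert rotTwo_smul,
      pow_smul_vert rotThree_smul]
    rfl

theorem exists_stabilizer_half {v : Fin 20} (hv : v ∈ halfVerts) (i : Fin 3) :
    ∃ g ∈ MulAction.stabilizer Icos baseCube, g • dart 0 0 = dart v i := by
  have : ∀ v ∈ halfVerts, ∀ i, ∃ k l m : Fin 3, wordPerm k l m 0 = v ∧
      wordPerm k l m (nbr 0 0) = nbr v i := by decide +kernel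
  obtain ⟨k, l, m, h1, h2⟩ := this v hv i
  obtain ⟨g, hg, hσ⟩ := exists_stabilizer_smul k l m
  exact ⟨g, hg, Dart.ext' ((hσ _).trans (congrArg vert h1)) ((hσ _).trans (congrArg vert h2))⟩

theorem exists_stabilizer_rev {v : Fin 20} {i : Fin 3} (hv : v ∉ baseVerts)
    (hi : nbr v i ∉ baseVerts) :
    ∃ g ∈ MulAction.stabilizer Icos baseCube, g • dart v i = (dart v i).rev := by
  have : ∀ v, v ∉ baseVerts → ∀ i, nbr v i ∉ baseVerts → ∃ k l m : Fin 3,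
      wordPerm k l m v = nbr v i ∧ wordPerm k l m (nbr v i) = v := by decide +kernel
  obtain ⟨k, l, m, h1, h2⟩ := this v hv i hi
  obtain ⟨g, hg, hσ⟩ := exists_stabilizer_smul k l m
  exact ⟨g, hg, Dart.ext' ((hσ _).trans (congrArg vert h1)) ((hσ _).trans (congrArg vert h2))⟩

theorem exists_stabilizer_anti {v : Fin 20} {i : Fin 3} (hv : v ∉ baseVerts)
    (hi : nbr v i ∉ baseVerts) :
    ∃ g ∈ MulAction.stabilizer Icos baseCube, g • dart v i = (dart v i).anti := by
  have : ∀ v, v ∉ baseVerts → ∀ i, nbr v i ∉ baseVerts → ∃ k l m : Fin 3,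
      wordPerm k l m v = v.rev ∧ wordPerm k l m (nbr v i) = (nbr v i).rev := by decide +kernel
  obtain ⟨k, l, m, h1, h2⟩ := this v hv i hi
  obtain ⟨g, hg, hσ⟩ := exists_stabilizer_smul k l m
  exact ⟨g, hg, Dart.ext' ((hσ _).trans ((congrArg vert h1).trans (anti_vert _).symm))
    ((hσ _).trans ((congrArg vert h2).trans (anti_vert _).symm))⟩

theorem mem_baseVerts_iff : ∀ v, v ∈ baseVerts ↔ v ∈ halfVerts ∨ v.rev ∈ halfVerts := by
  decide +kernel

theorem sign_of_mem : ∀ v ∈ halfVerts, sign v = 1 := by decide +kernel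

theorem sign_of_rev_mem : ∀ v, v.rev ∈ halfVerts → sign v = -1 := by decide +kernel

theorem sign_of_notMem : ∀ v, v ∉ baseVerts → sign v = 0 := by decide +kernel

theorem nbr_notMem : ∀ v ∈ baseVerts, ∀ i, nbr v i ∉ baseVerts := by decide +kernel

theorem exists_nbr_notMem : ∀ v, v ∉ baseVerts → ∃ i, nbr v i ∉ baseVerts := by decide +kernel

/-- Invariance of a 1-chain under the stabilizer of the standard cube, a group of order `12`. -/
def StabInvariant (z : C1) : Prop :=
  ∀ g ∈ MulAction.stabilizer Icos baseCube, MonoidAlgebra.of ℤ Icos g • z = z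

namespace StabInvariant

variable {z : C1}

theorem edge_smul_eq (h : StabInvariant z) {g : Icos} (hg : g ∈ MulAction.stabilizer Icos baseCube)
    (p : Dart) : edge z (g • p) = edge z p := by
  rw [← h g hg, edge_smul, inv_smul_smul, h g hg]

theorem trc_smul_eq (h : StabInvariant z) {g : Icos} (hg : g ∈ MulAction.stabilizer Icos baseCube)
    (p : Dart) : trc z (g • p) = trc z p := by
  rw [← h g hg, trc_smul, inv_smul_smul, h g hg]

theorem edge_of_mem (h : StabInvariant z) {v : Fin 20} (hv : v ∈ halfVerts) (i : Fin 3) :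
    edge z (dart v i) = edge z (dart 0 0) := by
  obtain ⟨g, hg, hd⟩ := exists_stabilizer_half hv i
  rw [← hd, h.edge_smul_eq hg]

theorem trc_of_mem (h : StabInvariant z) {v : Fin 20} (hv : v ∈ halfVerts) (i : Fin 3) :
    trc z (dart v i) = trc z (dart 0 0) := by
  obtain ⟨g, hg, hd⟩ := exists_stabilizer_half hv i
  rw [← hd, h.trc_smul_eq hg]

theorem edge_of_rev_mem (h : StabInvariant z) (hz : z ∈ Z1) {v : Fin 20} (hv : v.rev ∈ halfVerts)
    (i : Fin 3) : edge z (dart v i) = -edge z (dart 0 0) := by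
  obtain ⟨j, hj⟩ := exists_nbr_rev v i
  have h1 := (mem_Z1_iff z).1 hz (dart v i).anti
  rw [Dart.anti_anti, anti_dart hj, rot_dart, rot_dart, h.trc_of_mem hv, h.trc_of_mem hv,
    edge_rev, edge_rev, h.edge_of_mem hv] at h1
  linarith

theorem trc_of_rev_mem (h : StabInvariant z) {v : Fin 20} (hv : v.rev ∈ halfVerts)
    (i : Fin 3) : trc z (dart v i) = -trc z (dart 0 0) := by
  obtain ⟨j, hj⟩ := exists_nbr_rev v (i + 1)
  have h1 := trc_anti z (dart v (i + 1)).anti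
  rw [Dart.anti_anti, anti_dart hj, h.trc_of_mem hv, rot_dart, rot_dart] at h1
  have h2 : i + 1 + 1 + 1 = i := by
    clear hj h1
    revert i
    decide
  rwa [h2] at h1

/-- The edges that do not meet the standard cube are reversed by elements of the stabilizer. -/
theorem edge_eq_zero (h : StabInvariant z) {v : Fin 20} {i : Fin 3} (hv : v ∉ baseVerts)
    (hi : nbr v i ∉ baseVerts) : edge z (dart v i) = 0 := by
  obtain ⟨g, hg, hd⟩ := exists_stabilizer_rev hv hi
  have h1 := h.edge_smul_eq hg (dart v i)
  rw [hd, edge_rev] at h1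
  linarith

/-- An invariant cycle has coefficients of edge type proportional to those of `deltaEdge`. -/
theorem edge_eq (h : StabInvariant z) (hz : z ∈ Z1) (v : Fin 20) (i : Fin 3) :
    edge z (dart v i) = edge z (dart 0 0) * (sign v - sign (nbr v i)) := by
  by_cases hv : v ∈ baseVerts
  · rw [sign_of_notMem _ (nbr_notMem v hv i)]
    rcases (mem_baseVerts_iff v).1 hv with hv | hv
    · rw [h.edge_of_mem hv, sign_of_mem v hv]
      ring
    · rw [h.edge_of_rev_mem hz hv, sign_of_rev_mem v hv]
      ring
  · rw [sign_of_notMem v hv]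
    by_cases hw : nbr v i ∈ baseVerts
    · obtain ⟨j, hj⟩ := exists_nbr_nbr v i
      have h1 := edge_rev z (dart v i)
      rw [rev_dart hj] at h1
      rcases (mem_baseVerts_iff _).1 hw with hw | hw
      · rw [h.edge_of_mem hw] at h1
        rw [sign_of_mem _ hw]
        linarith
      · rw [h.edge_of_rev_mem hz hw] at h1
        rw [sign_of_rev_mem _ hw]
        linarith
    · rw [sign_of_notMem _ hw, h.edge_eq_zero hv hw]
      ring

/-- At a vertex outside the standard cube, some element of the stabilizer acts like the antipodal
map, so that the coefficients are invariant under a reflection; the cycle condition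
leaves only `0`. -/
theorem trc_eq_zero (h : StabInvariant z) (hz : z ∈ Z1) {v : Fin 20} (hv : v ∉ baseVerts)
    (j : Fin 3) : trc z (dart v j) = 0 := by
  obtain ⟨i, hi⟩ := exists_nbr_notMem v hv
  obtain ⟨g, hg, hd⟩ := exists_stabilizer_anti hv hi
  have hj : j = i ∨ j = i + 1 ∨ j = i + 1 + 1 := by
    clear hd hi
    revert i j
    decide
  set p := dart v i with hp
  have h0 : edge z p = 0 := h.edge_eq_zero hv hi
  have h0' : edge z p.anti = 0 := by rw [← hd, h.edge_smul_eq hg, h0]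
  have h1 : trc z p.anti = trc z p := by rw [← hd, h.trc_smul_eq hg]
  have h2 : trc z p.anti.rot = trc z p.rot := by rw [← hd, ← Dart.smul_rot, h.trc_smul_eq hg]
  have h3 := trc_anti z p.rot
  have h4 := trc_anti z p.rot.rot
  have h5 := (mem_Z1_iff z).1 hz p
  simp only [Dart.anti_rot, Dart.rot_rot_rot] at h3 h4
  rw [edge_rev, edge_rev, h0, h0'] at h5
  rcases hj with rfl | rfl | rfl
  · rw [← hp]
    linarith
  · rw [← rot_dart, ← hp]
    linarith
  · rw [← rot_dart, ← rot_dart, ← hp]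
    linarith

/-- An invariant cycle has coefficients of truncation type proportional to those of `deltaTrc`. -/
theorem trc_eq (h : StabInvariant z) (hz : z ∈ Z1) (v : Fin 20) (i : Fin 3) :
    trc z (dart v i) = trc z (dart 0 0) * sign v := by
  by_cases hv : v ∈ baseVerts
  · rcases (mem_baseVerts_iff v).1 hv with hv | hv
    · rw [h.trc_of_mem hv, sign_of_mem v hv, mul_one]
    · rw [h.trc_of_rev_mem hv, sign_of_rev_mem v hv]
      ring
  · rw [sign_of_notMem v hv, h.trc_eq_zero hz hv, mul_zero]

/-- The invariant cycles are spanned by `deltaTrc` and `deltaEdge`. -/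
theorem eq_smul_add_smul (h : StabInvariant z) (hz : z ∈ Z1) :
    z = trc z (dart 0 0) • deltaTrc baseCube.half + edge z (dart 0 0) • deltaEdge baseCube.half := by
  refine C1_ext (fun p => ?_) fun p => ?_ <;> obtain ⟨v, i, rfl⟩ := exists_dart p
  · rw [edge_add, edge_zsmul, edge_zsmul, edge_deltaTrc, edge_deltaEdge, dart_ini, dart_ter,
      signOf_half, signOf_half, h.edge_eq hz]
    ring
  · rw [trc_add, trc_zsmul, trc_zsmul, trc_deltaTrc, trc_deltaEdge, dart_ini,
      signOf_half, h.trc_eq hz]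
    ring

end StabInvariant

/-- There are no nonzero cycles that are invariant under the whole icosahedral group. -/
theorem eq_zero_of_invariant {z : C1} (hz : z ∈ Z1)
    (h : ∀ g : Icos, MonoidAlgebra.of ℤ Icos g • z = z) : z = 0 := by
  have hs : StabInvariant z := fun g _ => h g
  -- `rotFive` moves an edge that does not meet the standard cube to one that does.
  have hd : rotFive • dart 1 2 = dart 4 1 :=
    Dart.ext' ((rotFive_smul 1).trans (congrArg vert (by decide)))
      ((rotFive_smul (nbr 1 2)).trans (congrArg vert (by decide)))
  have h1 : edge z (dart 4 1) = edge z (dart 1 2) := by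
    rw [← hd, ← h rotFive, edge_smul, inv_smul_smul, h]
  have h2 : trc z (dart 4 1) = trc z (dart 1 2) := by
    rw [← hd, ← h rotFive, trc_smul, inv_smul_smul, h]
  rw [hs.edge_eq hz 4 1, hs.edge_eq hz 1 2] at h1
  rw [hs.trc_eq hz 4 1, hs.trc_eq hz 1 2] at h2
  have s4 : sign 4 = -1 := by decide
  have s5 : sign (nbr 1 2) = 0 := by decide
  have s10 : sign (nbr 4 1) = 0 := by decide
  have s1 : sign 1 = 0 := by decide
  rw [s4, s1, s5, s10] at h1
  rw [s4, s1] at h2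
  have h3 : edge z (dart 0 0) = 0 := by linarith
  have h4 : trc z (dart 0 0) = 0 := by linarith
  rw [hs.eq_smul_add_smul hz, h3, h4, zero_smul, zero_smul, add_zero]

/-! ### Homomorphisms defined on `V_o` -/

theorem bar_smul (g : Icos) (e : Cube) : (g • e).bar = MonoidAlgebra.of ℤ Icos g • e.bar := by
  classical
  refine Eq.trans (congrArg toVo ?_) (map_smul toVo _ _)
  refine funext fun f => Eq.trans ?_ (val_of_smul g _ f).symm
  change (Pi.single (g • e) 1 : Cube → ℤ) f = (Pi.single e 1 : Cube → ℤ) (g⁻¹ • f)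
  simp only [Pi.single_apply, inv_smul_eq_iff]

noncomputable instance : Fintype Cube := Fintype.ofFinite _

theorem toVo_eq_sum (c : Fn Cube) : toVo c = ∑ e : Cube, c.val e • e.bar := by
  classical
  have h : c.val = ∑ e : Cube, c.val e • (Pi.single e 1 : Cube → ℤ) := by
    funext f
    simp [Finset.sum_apply, Pi.single_apply]
  have h2 : c = ∑ e : Cube, c.val e • (Fn.mk (Pi.single e 1) : Fn Cube) := h
  conv_lhs => rw [h2, map_sum]
  exact Finset.sum_congr rfl fun e _ => map_zsmul toVo _ _

theorem span_bar : Submodule.span ZI {baseCube.bar} = ⊤ := by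
  rw [eq_top_iff]
  rintro x -
  obtain ⟨c, rfl⟩ := diagonal.mkQ_surjective x
  change toVo c ∈ _
  rw [toVo_eq_sum]
  refine Submodule.sum_mem _ fun e _ => zsmul_mem ?_ _
  obtain ⟨g, rfl⟩ := exists_smul_baseCube e
  rw [bar_smul]
  exact Submodule.smul_mem _ _ (Submodule.mem_span_singleton_self _)

section Hom

variable {M : Type} [AddCommGroup M] [Module ZI M]

theorem hom_ext {f f' : Vo →ₗ[ZI] M} (h : f baseCube.bar = f' baseCube.bar) : f = f' :=
  LinearMap.ext_on span_bar fun _ hx => by rwa [Set.mem_singleton_iff.1 hx]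

/-- A family of elements, indexed equivariantly by the cubes, with sum zero defines a
homomorphism on `V_o`. -/
theorem exists_hom (F : Cube → M) (hF : ∀ g e, F (g • e) = MonoidAlgebra.of ℤ Icos g • F e)
    (hsum : ∑ e, F e = 0) : ∃ u : Vo →ₗ[ZI] M, ∀ e, u e.bar = F e := by
  let L : Fn Cube →+ M :=
    { toFun := fun c => ∑ e, c.val e • F e
      map_zero' := Finset.sum_eq_zero fun e _ => zero_smul ℤ (F e)
      map_add' := fun a b => by
        rw [← Finset.sum_add_distrib]
        exact Finset.sum_congr rfl fun e _ => add_smul (a.val e) (b.val e) (F e) }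
  have hL : ∀ c, L c = ∑ e, c.val e • F e := fun _ => rfl
  have hsmul : ∀ (r : ZI) c, L (r • c) = r • L c := by
    intro r c
    induction r using MonoidAlgebra.induction_on with
    | of g =>
      rw [hL, hL, Finset.smul_sum]
      refine Fintype.sum_equiv (MulAction.toPerm g⁻¹) _ _ fun e => ?_
      rw [val_of_smul, MulAction.toPerm_apply, smul_comm, ← hF, smul_inv_smul]
    | add a b ha hb => rw [add_smul, add_smul, map_add, ha, hb]
    | smul n a ha => rw [smul_assoc, smul_assoc, map_zsmul, ha]
  let L' : Fn Cube →ₗ[ZI] M := { L with map_smul' := hsmul }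
  refine ⟨diagonal.liftQ L' fun c hc => ?_, fun e => ?_⟩
  · change ∑ e, c.val e • F e = 0
    have : ∀ e, c.val e • F e = c.val baseCube • F e := fun e =>
      congrArg (· • F e) (hc e baseCube)
    rw [Finset.sum_congr rfl fun e _ => this e, ← Finset.smul_sum, hsum, smul_zero]
  · classical
    change ∑ f, (Pi.single e 1 : Cube → ℤ) f • F f = F e
    simp [Pi.single_apply]

end Hom

/-! ### Homology -/

/-- Chains whose coefficients are all divisible by `n` are divisible by `n`. -/
theorem exists_zsmul_eq {n : ℤ} {y : C1} (h1 : ∀ p, n ∣ edge y p) (h2 : ∀ p, n ∣ trc y p) :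
    ∃ z : C1, n • z = y := by
  obtain ⟨z, hz1, hz2⟩ := exists_C1 (fun p => edge y p / n) (fun p => trc y p / n)
    (fun p => by rw [edge_rev, Int.neg_ediv_of_dvd (h1 p)])
    (fun p => by rw [trc_anti, Int.neg_ediv_of_dvd (h2 p)])
  refine ⟨z, C1_ext (fun p => ?_) fun p => ?_⟩
  · rw [edge_zsmul, hz1, Int.mul_ediv_cancel' (h1 p)]
  · rw [trc_zsmul, hz2, Int.mul_ediv_cancel' (h2 p)]

theorem zsmul_right_cancel_C1 {n : ℤ} (hn : n ≠ 0) {z z' : C1} (h : n • z = n • z') : z = z' := by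
  refine C1_ext (fun p => ?_) fun p => ?_
  · have := congrArg (edge · p) h
    simpa only [edge_zsmul, mul_right_inj' hn] using this
  · have := congrArg (trc · p) h
    simpa only [trc_zsmul, mul_right_inj' hn] using this

theorem mem_Z1_of_zsmul {n : ℤ} (hn : n ≠ 0) {z : C1} (h : n • z ∈ Z1) : z ∈ Z1 := by
  rw [mem_Z1_iff] at h ⊢
  intro p
  have := h p
  simp only [edge_zsmul, trc_zsmul] at this
  refine (mul_eq_zero.1 ?_).resolve_left hn
  linear_combination this

/-- The boundaries form a pure subgroup of the chains: if `∂ c` is divisible by `n` then `c` is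
constant modulo `n`, because the graph of edges is connected. -/
theorem mem_B1_of_zsmul {n : ℤ} (hn : n ≠ 0) {z : C1} (h : n • z ∈ B1) : z ∈ B1 := by
  obtain ⟨c, hc⟩ := h
  have hrev : ∀ p : Dart, faceVal c p.rev % n = faceVal c p % n := fun p => by
    have := congrArg (edge · p) hc
    simp only [edge_boundary2, edge_zsmul] at this
    exact Int.modEq_iff_dvd.2 ⟨_, this⟩
  have hrot2 : ∀ p : Dart, faceVal c p.rot.rot % n = faceVal c p % n := fun p => by
    rw [faceVal_rot_rot, hrev]
  have hrot : ∀ p : Dart, faceVal c p.rot % n = faceVal c p % n := fun p => by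
    rw [← hrot2, Dart.rot_rot_rot]
  have hconst := Dart.eq_of_rot_rev (fun p => faceVal c p % n) hrot hrev
  have hdvd : ∀ p, n ∣ faceVal c p - faceVal c (dart 0 0) := fun p =>
    Int.ModEq.dvd (hconst (dart 0 0) p)
  obtain ⟨c', hc'⟩ := exists_C2 (fun p => (faceVal c p - faceVal c (dart 0 0)) / n)
    (fun p => by rw [faceVal_rot_rot_rev])
  have hmul : ∀ p, n * faceVal c' p = faceVal c p - faceVal c (dart 0 0) := fun p => by
    rw [hc', Int.mul_ediv_cancel' (hdvd p)]
  refine ⟨c', zsmul_right_cancel_C1 hn ?_⟩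
  rw [← hc]
  refine C1_ext (fun p => ?_) fun p => ?_
  · rw [edge_zsmul, edge_boundary2, edge_boundary2, mul_sub, hmul, hmul]
    ring
  · rw [trc_zsmul, trc_boundary2, trc_boundary2, mul_sub, hmul, hmul]
    ring

theorem toH1_eq_zero_iff (z : Z1) : toH1 z = 0 ↔ (z : C1) ∈ B1 :=
  Submodule.Quotient.mk_eq_zero _

theorem toH1_surjective : Function.Surjective toH1 := Submodule.mkQ_surjective _

/-- `H₁(Σ)` is torsion free. -/
theorem H1_eq_zero_of_zsmul {n : ℤ} (hn : n ≠ 0) {x : H1} (h : n • x = 0) : x = 0 := by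
  obtain ⟨z, rfl⟩ := toH1_surjective x
  rw [← map_zsmul, toH1_eq_zero_iff] at h
  rw [toH1_eq_zero_iff]
  exact mem_B1_of_zsmul hn h

/-- A homomorphism on chains that vanishes on boundaries, on homology. -/
theorem exists_H1_hom (Φ : C1 →+ ℤ) (h : ∀ c, Φ (boundary2 c) = 0) :
    ∃ Ψ : H1 →+ ℤ, ∀ z : Z1, Ψ (toH1 z) = Φ z :=
  ⟨QuotientAddGroup.lift (B1.submoduleOf Z1).toAddSubgroup (Φ.comp Z1.subtype.toAddMonoidHom)
    (by rintro z ⟨c, hc⟩; exact (congrArg Φ hc).symm.trans (h c)), fun _ => rfl⟩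

/-! ### The colouring of the faces and divisibility by three -/

/-- The normal of a face has exactly one vanishing coordinate. The table gives the negative, modulo
`3`, of the index of that coordinate, for the face on the left of `dart v i`. -/
def colourTable : Fin 20 → Fin 3 → ℤ :=
  ![![0, 1, 2], ![0, 2, 2], ![1, 0, 0], ![2, 1, 1], ![2, 1, 0], ![2, 2, 0], ![2, 1, 0],
    ![0, 0, 1], ![2, 1, 0], ![1, 1, 2], ![2, 1, 1], ![0, 1, 2], ![1, 0, 0], ![0, 1, 2],
    ![0, 2, 2], ![0, 1, 2], ![1, 1, 2], ![0, 0, 1], ![2, 2, 0], ![2, 1, 0]]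

/-- The colour of the face on the left of an oriented edge. The stabilizer of the standard cube acts
simply transitively on the faces, and permutes the three colours through its quotient of order
three. -/
noncomputable def colour (p : Dart) : ℤ := colourTable (dartEquiv.symm p).1 (dartEquiv.symm p).2

theorem colour_dart (v : Fin 20) (i : Fin 3) : colour (dart v i) = colourTable v i := by
  have : dartEquiv.symm (dart v i) = (v, i) := dartEquiv.symm_apply_apply (v, i)
  simp only [colour, this]

/-- The cycle `deltaEdge` is divisible by three modulo boundaries. -/
theorem exists_three_zsmul_add_boundary2 :
    ∃ (m : C1) (c : C2), (3 : ℤ) • m + boundary2 c = deltaEdge baseCube.half := by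
  have h1 : ∀ v i j, nbr (nbr v i) j = v →
      colourTable (nbr v i) (j + 1 + 1) = colourTable v i := by decide +kernel
  have h2 : ∀ v i j, nbr (nbr v i) j = v →
      3 ∣ sign v - sign (nbr v i) - (colourTable v i - colourTable (nbr v i) j) := by
    decide +kernel
  have h3 : ∀ v i j k, nbr v.rev j = (nbr v i).rev → nbr (nbr v.rev j) k = v.rev →
      3 ∣ 0 - (colourTable (nbr v.rev j) k - colourTable v i) := by decide +kernel
  obtain ⟨c, hc⟩ := exists_C2 colour fun p => by
    obtain ⟨v, i, rfl⟩ := exists_dart p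
    obtain ⟨j, hj⟩ := exists_nbr_nbr v i
    rw [rev_dart hj, rot_dart, rot_dart, colour_dart, colour_dart, h1 v i j hj]
  obtain ⟨m, hm⟩ := exists_zsmul_eq (n := 3) (y := deltaEdge baseCube.half - boundary2 c)
    (fun p => by
      obtain ⟨v, i, rfl⟩ := exists_dart p
      obtain ⟨j, hj⟩ := exists_nbr_nbr v i
      change 3 ∣ edge (deltaEdge baseCube.half) (dart v i) - edge (boundary2 c) (dart v i)
      rw [edge_deltaEdge, edge_boundary2, hc, hc, rev_dart hj, colour_dart, colour_dart, dart_ini,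
        dart_ter, signOf_half, signOf_half]
      exact h2 v i j hj)
    (fun p => by
      obtain ⟨v, i, rfl⟩ := exists_dart p
      obtain ⟨j, hj⟩ := exists_nbr_rev v i
      obtain ⟨k, hk⟩ := exists_nbr_nbr v.rev j
      change 3 ∣ trc (deltaEdge baseCube.half) (dart v i) - trc (boundary2 c) (dart v i)
      rw [trc_deltaEdge, trc_boundary2, hc, hc, anti_dart hj, rev_dart hk, colour_dart,
        colour_dart]
      exact h3 v i j k hj hk)
  exact ⟨m, c, by rw [hm, sub_add_cancel]⟩

/-! ### Two functionals on homology -/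

/-- The intersection number with a loop parallel to the loop of edge type along `dart 0 0`: it enters
the face on the left of this edge through the side near one end, and leaves it through the side
near the other end. -/
noncomputable def crossTrc : C1 →+ ℤ := trcHom (dart 0 0) - trcHom (dart 0 0).rev.rot.rot

/-- The intersection number with the loop around vertex `0`. -/
noncomputable def crossEdge : C1 →+ ℤ :=
  edgeHom (dart 0 0) + edgeHom (dart 0 1) + edgeHom (dart 0 2)

theorem crossTrc_boundary2 (c : C2) : crossTrc (boundary2 c) = 0 := by
  change trc (boundary2 c) (dart 0 0) - trc (boundary2 c) (dart 0 0).rev.rot.rot = 0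
  have : faceVal c (dart 0 0).rev.rot.rot.anti.rev = faceVal c (dart 0 0).anti.rev := by
    simp only [Dart.anti_rot, Dart.rot_rot_rot]
    rw [← faceVal_rot_rot, Dart.rot_rot_rot]
    rfl
  rw [trc_boundary2, trc_boundary2, faceVal_rot_rot_rev, this]
  ring

theorem crossEdge_boundary2 (c : C2) : crossEdge (boundary2 c) = 0 := by
  change edge (boundary2 c) (dart 0 0) + edge (boundary2 c) (dart 0 1) +
    edge (boundary2 c) (dart 0 2) = 0
  have h0 := faceVal_rot_rot c (dart 0 0)
  have h1 := faceVal_rot_rot c (dart 0 1)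
  have h2 := faceVal_rot_rot c (dart 0 2)
  simp only [rot_dart] at h0 h1 h2
  simp only [edge_boundary2, ← h0, ← h1, ← h2]
  simp only [show (0 : Fin 3) + 1 + 1 = 2 from rfl, show (1 : Fin 3) + 1 + 1 = 0 from rfl,
    show (2 : Fin 3) + 1 + 1 = 1 from rfl]
  ring

theorem crossTrc_deltaTrc : crossTrc (deltaTrc baseCube.half) = 1 := by
  change trc (deltaTrc _) (dart 0 0) - trc (deltaTrc _) (dart 0 0).rev.rot.rot = 1
  have : (dart 0 0).rev.rot.rot.ini = vert 1 := by
    rw [Dart.rot_ini, Dart.rot_ini]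
    rfl
  rw [trc_deltaTrc, trc_deltaTrc, this, dart_ini, signOf_half, signOf_half]
  decide

theorem crossTrc_deltaEdge : crossTrc (deltaEdge baseCube.half) = 0 := rfl

theorem crossEdge_deltaTrc : crossEdge (deltaTrc baseCube.half) = 0 := rfl

theorem crossEdge_deltaEdge : crossEdge (deltaEdge baseCube.half) = 3 := by
  change edge (deltaEdge _) (dart 0 0) + edge (deltaEdge _) (dart 0 1) +
    edge (deltaEdge _) (dart 0 2) = 3
  simp only [edge_deltaEdge, dart_ini, dart_ter, signOf_half]
  decide

/-! ### The homomorphisms into the cycles -/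

theorem of_smul_bar {g : Icos} (hg : g ∈ MulAction.stabilizer Icos baseCube) :
    MonoidAlgebra.of ℤ Icos g • baseCube.bar = baseCube.bar := by
  rw [← bar_smul, MulAction.mem_stabilizer_iff.1 hg]

theorem stabInvariant_apply (u : Vo →ₗ[ZI] Z1) : StabInvariant (u baseCube.bar : C1) :=
  fun g hg => by
    rw [← Submodule.coe_smul, ← map_smul, of_smul_bar hg]

/-- An equivariant family of cycles indexed by the cubes sums to zero, and so it defines a
homomorphism. -/
theorem exists_hom_Z1 (F : Set Vertex → C1) (hmem : ∀ E, F E ∈ Z1)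
    (hF : ∀ (g : Icos) E, F ((g • ·) '' E) = MonoidAlgebra.of ℤ Icos g • F E) :
    ∃ u : Vo →ₗ[ZI] Z1, (u baseCube.bar : C1) = F baseCube.half := by
  have hsmul : ∀ g (e : Cube), F (g • e).half = MonoidAlgebra.of ℤ Icos g • F e.half :=
    fun g e => by rw [half_smul, hF]
  have hsum : ∑ e : Cube, F e.half = 0 := by
    refine eq_zero_of_invariant (Submodule.sum_mem _ fun e _ => hmem _) fun g => ?_
    rw [Finset.smul_sum]
    exact Fintype.sum_equiv (MulAction.toPerm g) _ _ fun e => (hsmul g e).symm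
  obtain ⟨u, hu⟩ := exists_hom (fun e : Cube => (⟨F e.half, hmem _⟩ : Z1))
    (fun g e => Subtype.ext (hsmul g e))
    (Subtype.ext (by rw [Submodule.coe_sum]; exact hsum))
  exact ⟨u, congrArg Subtype.val (hu baseCube)⟩

/-- Two elements that generate an abelian group and satisfy no relation form a basis. -/
theorem exists_basis_pair {A : Type*} [AddCommGroup A] (x y : A)
    (hsp : ∀ f, ∃ a b : ℤ, f = a • x + b • y)
    (hli : ∀ a b : ℤ, a • x + b • y = 0 → a = 0 ∧ b = 0) :
    ∃ b : Module.Basis (Fin 2) ℤ A, b 0 = x ∧ b 1 = y := by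
  have h1 : LinearIndependent ℤ ![x, y] := LinearIndependent.pair_iff.2 hli
  have h2 : ⊤ ≤ Submodule.span ℤ (Set.range ![x, y]) := fun f _ => by
    obtain ⟨a, b, rfl⟩ := hsp f
    refine add_mem (zsmul_mem (Submodule.subset_span (Set.mem_range_self (0 : Fin 2))) _)
      (zsmul_mem (Submodule.subset_span (Set.mem_range_self (1 : Fin 2))) _)
  exact ⟨Module.Basis.mk h1 h2, by simp, by simp⟩

/-- The homomorphism with `baseCube.bar ↦ deltaTrc baseCube.half`. -/
noncomputable def homTrc : Vo →ₗ[ZI] Z1 :=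
  (exists_hom_Z1 deltaTrc deltaTrc_mem_Z1 deltaTrc_image_smul).choose

theorem homTrc_bar : (homTrc baseCube.bar : C1) = deltaTrc baseCube.half :=
  (exists_hom_Z1 deltaTrc deltaTrc_mem_Z1 deltaTrc_image_smul).choose_spec

/-- The homomorphism with `baseCube.bar ↦ deltaEdge baseCube.half`. -/
noncomputable def homEdge : Vo →ₗ[ZI] Z1 :=
  (exists_hom_Z1 deltaEdge deltaEdge_mem_Z1 deltaEdge_image_smul).choose

theorem homEdge_bar : (homEdge baseCube.bar : C1) = deltaEdge baseCube.half :=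
  (exists_hom_Z1 deltaEdge deltaEdge_mem_Z1 deltaEdge_image_smul).choose_spec

theorem exists_eq_of_stabInvariant {z : Z1} (h : StabInvariant (z : C1)) :
    ∃ a b : ℤ, z = a • homTrc baseCube.bar + b • homEdge baseCube.bar := by
  have h1 := h.eq_smul_add_smul z.2
  rw [← homTrc_bar, ← homEdge_bar] at h1
  exact ⟨_, _, Subtype.ext h1⟩

theorem hom_Z1_eq (u : Vo →ₗ[ZI] Z1) : ∃ a b : ℤ, u = a • homTrc + b • homEdge := by
  obtain ⟨a, b, h⟩ := exists_eq_of_stabInvariant (stabInvariant_apply u)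
  exact ⟨a, b, hom_ext h⟩

theorem crossTrc_comb (a b : ℤ) :
    crossTrc (a • deltaTrc baseCube.half + b • deltaEdge baseCube.half) = a := by
  rw [map_add, map_zsmul, map_zsmul, crossTrc_deltaTrc, crossTrc_deltaEdge]
  simp

theorem crossEdge_comb (a b : ℤ) :
    crossEdge (a • deltaTrc baseCube.half + b • deltaEdge baseCube.half) = 3 * b := by
  rw [map_add, map_zsmul, map_zsmul, crossEdge_deltaTrc, crossEdge_deltaEdge]
  simp [mul_comm]

theorem exists_basis_hom_Z1 :
    ∃ b : Module.Basis (Fin 2) ℤ (Vo →ₗ[ZI] Z1), b 0 = homTrc ∧ b 1 = homEdge := by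
  refine exists_basis_pair homTrc homEdge hom_Z1_eq fun a b h => ?_
  have h0 : a • deltaTrc baseCube.half + b • deltaEdge baseCube.half = 0 := by
    rw [← homTrc_bar, ← homEdge_bar]
    exact congrArg (fun u : Vo →ₗ[ZI] Z1 => (u baseCube.bar : C1)) h
  have h1 := crossTrc_comb a b
  have h2 := crossEdge_comb a b
  rw [h0, map_zero] at h1 h2
  omega

theorem hom_B1_eq_zero (f : Vo →ₗ[ZI] B1) : f = 0 := by
  have hle : B1 ≤ Z1 := by
    rintro _ ⟨c, rfl⟩
    exact boundary2_mem_Z1 c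
  obtain ⟨a, b, hab⟩ := hom_Z1_eq (Submodule.inclusion hle ∘ₗ f)
  have h0 : (f baseCube.bar : C1) =
      a • deltaTrc baseCube.half + b • deltaEdge baseCube.half := by
    rw [← homTrc_bar, ← homEdge_bar]
    exact congrArg (fun u : Vo →ₗ[ZI] Z1 => (u baseCube.bar : C1)) hab
  obtain ⟨c, hc⟩ := (f baseCube.bar).2
  have h1 := crossTrc_comb a b
  have h2 := crossEdge_comb a b
  rw [← h0, ← hc, crossTrc_boundary2] at h1
  rw [← h0, ← hc, crossEdge_boundary2] at h2
  refine hom_ext (Subtype.ext ?_)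
  rw [h0, ← h1, show b = 0 by omega, zero_smul, zero_smul, add_zero]
  rfl

/-! ### The homomorphisms into the homology -/

instance : Finite Icos := by
  refine Finite.of_injective (fun (g : Icos) (v : Fin 20) => g • vert v) fun g h hgh => ?_
  have hcol : ∀ v, g.mat *ᵥ (vert v).1 = h.mat *ᵥ (vert v).1 := fun v =>
    congrArg Subtype.val (congrFun hgh v)
  have hsingle : ∀ i, ∃ v w, (Pi.single i 1 : Fin 3 → ℝ) =
      (1 / 2 : ℝ) • ((vert v).1 + (vert w).1) := by
    have key : ∀ i, ∃ v w, ∀ j, coord v j + coord w j = if j = i then 2 else 0 := by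
      decide +kernel
    intro i
    obtain ⟨v, w, hvw⟩ := key i
    refine ⟨v, w, funext fun j => ?_⟩
    have := congrArg toReal (hvw j)
    rw [map_add] at this
    simp only [Pi.smul_apply, Pi.add_apply, vert_val, this, Pi.single_apply]
    split_ifs
    · rw [map_ofNat]
      norm_num
    · simp
  refine Subtype.ext (Subtype.ext (Matrix.ext_of_mulVec_single fun i => ?_))
  obtain ⟨v, w, hi⟩ := hsingle i
  change g.mat *ᵥ _ = h.mat *ᵥ _
  rw [hi, Matrix.mulVec_smul, Matrix.mulVec_add, hcol, hcol, ← Matrix.mulVec_add,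
    ← Matrix.mulVec_smul]

noncomputable instance : Fintype Icos := Fintype.ofFinite _

/-- A homomorphism into a torsion free module is divisible by `n` if its value at the generator
is. -/
theorem exists_zsmul_hom_eq {M : Type} [AddCommGroup M] [Module ZI M] {n : ℤ}
    (hn : ∀ x : M, n • x = 0 → x = 0) (f : Vo →ₗ[ZI] M) {y : M} (hy : n • y = f baseCube.bar) :
    ∃ w : Vo →ₗ[ZI] M, n • w = f := by
  let μ : M →ₗ[ZI] M := n • LinearMap.id
  have hμ : Function.Injective μ := (injective_iff_map_eq_zero μ).2 hn
  have hmem : ∀ x, f x ∈ LinearMap.range μ := by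
    have : (⊤ : Submodule ZI Vo) ≤ (LinearMap.range μ).comap f := by
      rw [← span_bar, Submodule.span_singleton_le_iff_mem]
      exact ⟨y, hy⟩
    exact fun x => this trivial
  refine ⟨(LinearEquiv.ofInjective μ hμ).symm.toLinearMap ∘ₗ f.codRestrict _ hmem,
    LinearMap.ext fun x => ?_⟩
  have := congrArg Subtype.val
    ((LinearEquiv.ofInjective μ hμ).apply_symm_apply (f.codRestrict _ hmem x))
  exact this

theorem exists_three_zsmul_hom_eq : ∃ w : Vo →ₗ[ZI] H1, (3 : ℤ) • w = pStar homEdge := by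
  obtain ⟨m, c, hmc⟩ := exists_three_zsmul_add_boundary2
  have h3 : (3 : ℤ) • m = deltaEdge baseCube.half - boundary2 c := eq_sub_of_add_eq hmc
  have hm : m ∈ Z1 := by
    refine mem_Z1_of_zsmul (n := 3) (by norm_num) ?_
    rw [h3]
    exact sub_mem (deltaEdge_mem_Z1 _) (boundary2_mem_Z1 c)
  refine exists_zsmul_hom_eq (fun x => H1_eq_zero_of_zsmul (by norm_num)) (pStar homEdge)
    (y := toH1 ⟨m, hm⟩) ?_
  change _ = toH1 (homEdge baseCube.bar)
  rw [← map_zsmul, ← sub_eq_zero, ← map_sub, toH1_eq_zero_iff]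
  refine ⟨-c, ?_⟩
  change boundary2 (-c) = (3 : ℤ) • m - (homEdge baseCube.bar : C1)
  rw [h3, homEdge_bar, map_neg]
  abel

/-- By averaging over the stabilizer, a multiple of each homomorphism into the homology lifts to
the cycles. -/
theorem exists_zsmul_eq_pStar (f : Vo →ₗ[ZI] H1) :
    ∃ n : ℤ, n ≠ 0 ∧ ∃ u, n • f = pStar u := by
  classical
  obtain ⟨m, hm⟩ := toH1_surjective (f baseCube.bar)
  let G := MulAction.stabilizer Icos baseCube
  have hinv : StabInvariant (∑ g : G, MonoidAlgebra.of ℤ Icos g.1 • m : Z1) := fun h hh => by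
    rw [← Submodule.coe_smul, Finset.smul_sum]
    refine congrArg Subtype.val (Fintype.sum_equiv (Equiv.mulLeft (⟨h, hh⟩ : G)) _ _ fun g => ?_)
    rw [← mul_smul, ← map_mul]
    rfl
  obtain ⟨a, b, hab⟩ := exists_eq_of_stabInvariant hinv
  refine ⟨Fintype.card G, by exact_mod_cast Fintype.card_ne_zero, a • homTrc + b • homEdge,
    hom_ext ?_⟩
  refine Eq.trans ?_ (congrArg toH1 hab)
  rw [map_sum]
  have h2 : ∀ g : G, toH1 (MonoidAlgebra.of ℤ Icos g.1 • m) = f baseCube.bar := fun g => by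
    rw [map_smul, hm, ← map_smul, of_smul_bar g.2]
  rw [Finset.sum_congr rfl fun g _ => h2 g, Finset.sum_const, Finset.card_univ,
    LinearMap.smul_apply, natCast_zsmul]

/-- The third part of the image of `homEdge` in the homology. -/
noncomputable def homThird : Vo →ₗ[ZI] H1 := exists_three_zsmul_hom_eq.choose

theorem three_zsmul_homThird : (3 : ℤ) • homThird = pStar homEdge :=
  exists_three_zsmul_hom_eq.choose_spec

/-- The functional `crossTrc` on homology. -/
noncomputable def crossTrcH1 : H1 →+ ℤ := (exists_H1_hom crossTrc crossTrc_boundary2).choose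

theorem crossTrcH1_toH1 (z : Z1) : crossTrcH1 (toH1 z) = crossTrc z :=
  (exists_H1_hom crossTrc crossTrc_boundary2).choose_spec z

/-- The functional `crossEdge` on homology. -/
noncomputable def crossEdgeH1 : H1 →+ ℤ := (exists_H1_hom crossEdge crossEdge_boundary2).choose

theorem crossEdgeH1_toH1 (z : Z1) : crossEdgeH1 (toH1 z) = crossEdge z :=
  (exists_H1_hom crossEdge crossEdge_boundary2).choose_spec z

/-- The value of `crossTrc` at the image of the standard cube. -/
noncomputable def evalTrc : (Vo →ₗ[ZI] H1) →+ ℤ where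
  toFun f := crossTrcH1 (f baseCube.bar)
  map_zero' := map_zero crossTrcH1
  map_add' _ _ := map_add crossTrcH1 _ _

/-- The value of `crossEdge` at the image of the standard cube. -/
noncomputable def evalEdge : (Vo →ₗ[ZI] H1) →+ ℤ where
  toFun f := crossEdgeH1 (f baseCube.bar)
  map_zero' := map_zero crossEdgeH1
  map_add' _ _ := map_add crossEdgeH1 _ _

theorem evalTrc_pStar (u : Vo →ₗ[ZI] Z1) : evalTrc (pStar u) = crossTrc (u baseCube.bar : C1) :=
  crossTrcH1_toH1 _

theorem evalEdge_pStar (u : Vo →ₗ[ZI] Z1) :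
    evalEdge (pStar u) = crossEdge (u baseCube.bar : C1) :=
  crossEdgeH1_toH1 _

theorem evalTrc_comb (a b : ℤ) : evalTrc (a • pStar homTrc + b • homThird) = a := by
  have h1 : evalTrc (pStar homTrc) = 1 := by rw [evalTrc_pStar, homTrc_bar, crossTrc_deltaTrc]
  have h2 : 3 * evalTrc homThird = 0 := by
    rw [← smul_eq_mul, ← map_zsmul, three_zsmul_homThird, evalTrc_pStar, homEdge_bar,
      crossTrc_deltaEdge]
  rw [map_add, map_zsmul, map_zsmul, h1, show evalTrc homThird = 0 by omega]
  simp

theorem evalEdge_comb (a b : ℤ) : evalEdge (a • pStar homTrc + b • homThird) = b := by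
  have h1 : evalEdge (pStar homTrc) = 0 := by rw [evalEdge_pStar, homTrc_bar, crossEdge_deltaTrc]
  have h2 : 3 * evalEdge homThird = 3 := by
    rw [← smul_eq_mul, ← map_zsmul, three_zsmul_homThird, evalEdge_pStar, homEdge_bar,
      crossEdge_deltaEdge]
  rw [map_add, map_zsmul, map_zsmul, h1, show evalEdge homThird = 1 by omega]
  simp

/-- The coordinates of a homomorphism into the homology are given by the two functionals: some
nonzero multiple of it is in the span of `pStar homTrc` and `homThird`, and the homology is torsion
free. -/
theorem hom_H1_eq (f : Vo →ₗ[ZI] H1) :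
    f = evalTrc f • pStar homTrc + evalEdge f • homThird := by
  obtain ⟨n, hn, u, hu⟩ := exists_zsmul_eq_pStar f
  obtain ⟨a, b, rfl⟩ := hom_Z1_eq u
  have h1 : n • f = a • pStar homTrc + (b * 3) • homThird := by
    rw [hu, map_add, map_zsmul, map_zsmul, mul_smul, three_zsmul_homThird]
  have h2 : n * evalTrc f = a := by rw [← smul_eq_mul, ← map_zsmul, h1, evalTrc_comb]
  have h3 : n * evalEdge f = b * 3 := by rw [← smul_eq_mul, ← map_zsmul, h1, evalEdge_comb]
  have h4 : n • (f - (evalTrc f • pStar homTrc + evalEdge f • homThird)) = 0 := by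
    rw [smul_sub, h1, smul_add, smul_smul, smul_smul, h2, h3, sub_self]
  rw [← sub_eq_zero]
  exact LinearMap.ext fun x => H1_eq_zero_of_zsmul hn (congrArg (· x) h4)

theorem exists_basis_hom_H1 :
    ∃ b : Module.Basis (Fin 2) ℤ (Vo →ₗ[ZI] H1), b 0 = pStar homTrc ∧ b 1 = homThird := by
  refine exists_basis_pair _ _ (fun f => ⟨_, _, hom_H1_eq f⟩) fun a b h => ?_
  have h1 := evalTrc_comb a b
  have h2 := evalEdge_comb a b
  rw [h, map_zero] at h1 h2
  exact ⟨h1.symm, h2.symm⟩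

theorem mem_range_pStar_iff (f : Vo →ₗ[ZI] H1) :
    f ∈ AddMonoidHom.range (G := Vo →ₗ[ZI] Z1) pStar ↔ 3 ∣ evalEdge f := by
  constructor
  · rintro ⟨u, rfl⟩
    obtain ⟨a, b, rfl⟩ := hom_Z1_eq u
    rw [map_add, map_zsmul, map_zsmul, ← three_zsmul_homThird, smul_smul, evalEdge_comb]
    exact dvd_mul_left 3 b
  · rintro ⟨b, hb⟩
    refine ⟨evalTrc f • homTrc + b • homEdge, ?_⟩
    rw [map_add, map_zsmul, map_zsmul, ← three_zsmul_homThird, smul_smul, mul_comm b, ← hb,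
      ← hom_H1_eq]

/-- The cokernel of `pStar` is isomorphic to `ℤ / 3`. -/
theorem nonempty_cokerPStar_equiv : Nonempty (CokerPStar ≃+ ZMod 3) := by
  let φ : (Vo →ₗ[ZI] H1) →+ ZMod 3 := (Int.castAddHom (ZMod 3)).comp evalEdge
  have hφ : Function.Surjective φ := fun x => by
    obtain ⟨n, rfl⟩ := ZMod.intCast_surjective x
    refine ⟨n • homThird, congrArg (Int.cast : ℤ → ZMod 3) ?_⟩
    have := evalEdge_comb 0 n
    rwa [zero_smul, zero_add] at this
  have hker : AddMonoidHom.range (G := Vo →ₗ[ZI] Z1) pStar = φ.ker := by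
    ext f
    rw [mem_range_pStar_iff, AddMonoidHom.mem_ker]
    exact (ZMod.intCast_zmod_eq_zero_iff_dvd (evalEdge f) 3).symm
  exact ⟨(QuotientAddGroup.quotientAddEquivOfEq hker).trans
    (QuotientAddGroup.quotientKerEquivOfSurjective φ hφ)⟩

/-! ### Arbitrary cubes and halves -/

/-- Every pair of a cube and one of its halves comes from the standard one, up to the sign that
belongs to the choice of the half. -/
theorem Cube.IsHalf.exists_eq {e : Cube} {E : Set Vertex} (h : e.IsHalf E) :
    ∃ (g : Icos) (ε : ℤˣ), e = g • baseCube ∧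
      deltaTrc E = (ε : ℤ) • MonoidAlgebra.of ℤ Icos g • deltaTrc baseCube.half ∧
      deltaEdge E = (ε : ℤ) • MonoidAlgebra.of ℤ Icos g • deltaEdge baseCube.half := by
  obtain ⟨g, rfl⟩ := exists_smul_baseCube e
  have h1 := h.smul g⁻¹
  rw [inv_smul_smul] at h1
  have h2 : (g • ·) '' ((g⁻¹ • ·) '' E) = E := by
    simp only [Set.image_image, smul_inv_smul, Set.image_id']
  rcases eq_half_of_isHalf h1 with h3 | h3 <;> rw [h3] at h2 <;> rw [← h2]
  · refine ⟨g, 1, rfl, ?_, ?_⟩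
    · rw [deltaTrc_image_smul, Units.val_one, one_smul]
    · rw [deltaEdge_image_smul, Units.val_one, one_smul]
  · refine ⟨g, -1, rfl, ?_, ?_⟩
    · rw [deltaTrc_image_smul, deltaTrc_image_anti, smul_comm]
      rfl
    · rw [deltaEdge_image_smul, deltaEdge_image_anti, smul_comm]
      rfl

/-- A homomorphism on `V_o` is determined by its value at any cube. -/
theorem apply_bar_eq_iff (u u' : Vo →ₗ[ZI] Z1) (g : Icos) (n : ℤ) :
    (u (g • baseCube).bar : C1) = n • MonoidAlgebra.of ℤ Icos g • (u' baseCube.bar : C1) ↔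
      u = n • u' := by
  constructor
  · intro h
    have h1 : u (g • baseCube).bar = (n • u') (g • baseCube).bar := by
      refine Subtype.ext (h.trans ?_)
      rw [bar_smul, map_smul, LinearMap.smul_apply, smul_comm]
      rfl
    have h2 := congrArg (MonoidAlgebra.of ℤ Icos g⁻¹ • ·) h1
    simp only [← map_smul, ← bar_smul, inv_smul_smul] at h2
    exact hom_ext h2
  · rintro rfl
    rw [bar_smul, map_smul, LinearMap.smul_apply, smul_comm]
    rfl

end Dodec

theorem mainTheorem4 :
    (∀ f : Dodec.Vo →ₗ[Dodec.ZI] Dodec.B1, f = 0) ∧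
    IsAddCyclic Dodec.CokerPStar ∧
    Nat.card Dodec.CokerPStar = 3 ∧
    ∀ (e : Dodec.Cube) (E : Set Dodec.Vertex), e.IsHalf E →
      (∃! u : Dodec.Vo →ₗ[Dodec.ZI] Dodec.Z1, (u e.bar : Dodec.C1) = Dodec.deltaTrc E) ∧
      (∃! u : Dodec.Vo →ₗ[Dodec.ZI] Dodec.Z1, (u e.bar : Dodec.C1) = Dodec.deltaEdge E) ∧
      ∀ uTrc uEdge : Dodec.Vo →ₗ[Dodec.ZI] Dodec.Z1,
        (uTrc e.bar : Dodec.C1) = Dodec.deltaTrc E →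
        (uEdge e.bar : Dodec.C1) = Dodec.deltaEdge E →
        (∃ b : Module.Basis (Fin 2) ℤ (Dodec.Vo →ₗ[Dodec.ZI] Dodec.Z1),
          b 0 = uTrc ∧ b 1 = uEdge) ∧
        ∃ w : Dodec.Vo →ₗ[Dodec.ZI] Dodec.H1, (3 : ℤ) • w = Dodec.pStar uEdge ∧
          ∃ b : Module.Basis (Fin 2) ℤ (Dodec.Vo →ₗ[Dodec.ZI] Dodec.H1),
            b 0 = Dodec.pStar uTrc ∧ b 1 = w := by
  obtain ⟨φ⟩ := Dodec.nonempty_cokerPStar_equiv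
  refine ⟨Dodec.hom_B1_eq_zero, ?_, ?_, ?_⟩
  · exact isAddCyclic_of_surjective φ.symm.toAddMonoidHom φ.symm.surjective
  · rw [Nat.card_congr φ.toEquiv, Nat.card_zmod]
  · intro e E hE
    obtain ⟨g, ε, rfl, hT, hD⟩ := hE.exists_eq
    simp only [hT, hD, ← Dodec.homTrc_bar, ← Dodec.homEdge_bar, Dodec.apply_bar_eq_iff]
    refine ⟨⟨_, rfl, fun _ h => h⟩, ⟨_, rfl, fun _ h => h⟩, ?_⟩
    rintro _ _ rfl rfl
    obtain ⟨b, hb0, hb1⟩ := Dodec.exists_basis_hom_Z1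
    obtain ⟨b', hb0', hb1'⟩ := Dodec.exists_basis_hom_H1
    refine ⟨⟨b.unitsSMul fun _ => ε, ?_, ?_⟩, (ε : ℤ) • Dodec.homThird, ?_,
      b'.unitsSMul fun _ => ε, ?_, ?_⟩
    · rw [Module.Basis.unitsSMul_apply, hb0]
      rfl
    · rw [Module.Basis.unitsSMul_apply, hb1]
      rfl
    · rw [map_zsmul, ← Dodec.three_zsmul_homThird, smul_comm]
    · rw [Module.Basis.unitsSMul_apply, hb0', map_zsmul]
      rfl
    · rw [Module.Basis.unitsSMul_apply, hb1']
      rfl
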